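/- **Conventions.** A (finite) poset is a finite set $P$ with a strict order relation $\prec$, i.e. a transitive and irreflexive relation. For finite posets $(P,\prec)$ and $(Q,\ll)$, let $t(P,Q)$ be the number of maps $f:P\to Q$ (not necessarily injective) such that $a\prec b$ implies $f(a)\ll f(b)$, divided by the number $|Q|^{|P|}$ of all maps $P\to Q$. A sequence $(P_n)_{n\in\mathbb N}$ of finite posets *converges* if $|P_n|\to\infty$ and, for every finite poset $P$, the sequence $(t(P,P_n))_{n\in\mathbb N}$ converges. An *ordered probability space* $(S,\mathcal F,\mu,\vartriangleleft)$ is a probability space $(S,\mathcal F,\mu)$ with a strict order relation $\vartriangleleft$ on $S$ such that $\{(x,y):x\vartriangleleft y\}$ is $\mathcal F\otimes\mathcal F$-measurable. A *poset kernel* $(S,\mathcal F,\mu,\vartriangleleft,W)$ consists of an ordered probability space and an $\mathcal F\otimes\mathcal F$-measurable function $W:S\times S\to[0,1]$ such that for all $x,y,z\in S$: $W(x,y)>0$ implies $x\vartriangleleft y$; and $W(x,y)>0$ together with $W(y,z)>0$ implies $W(x,z)=1$. The density of a finite poset $(P,\prec)$ in it is $$t(P,W)=\int_{S^{P}}\ \prod_{a,b\in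 P,\ a\prec b}W(x_a,x_b)\ \prod_{a\in P}\mathrm d\mu(x_a).$$ **Theorem.** For every convergent sequence $(P_n)_{n\in\mathbb N}$ of finite posets there is a function $U:[0,1]^2\to[0,1]$ such that $([0,1],\mathcal B,\lambda,<,U)$ is a poset kernel, where $\mathcal B$ is the Borel $\sigma$-algebra, $\lambda$ is Lebesgue measure and $<$ is the standard order on $[0,1]$, and $$t(P,U)=\lim_{n\to\infty}t(P,P_n)\qquad\text{for every finite poset }P.$$ -/

import Mathlib

open MeasureTheory Filter Topology

universe u v

/-- Homomorphism density of finite posets: the proportion of all maps `f : P → Q` for which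
`a < b` in `P` implies `f a < f b` in `Q`. -/
noncomputable def posetDensity (P Q : Type*) [Fintype P] [PartialOrder P]
    [Fintype Q] [PartialOrder Q] : ℝ :=
  (Nat.card {f : P → Q // StrictMono f} : ℝ) / (Nat.card (P → Q) : ℝ)

/-- Convergence of a sequence of finite posets: the sizes tend to infinity and, for every finite
poset `P`, the sequence of densities of `P` converges. -/
def PosetSeqConverges (Q : ℕ → Type u) [∀ n, Fintype (Q n)] [∀ n, PartialOrder (Q n)] :
    Prop :=
  Tendsto (fun n => Fintype.card (Q n)) atTop atTop ∧
    ∀ (P : Type v) [Fintype P] [PartialOrder P],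
      ∃ l : ℝ, Tendsto (fun n => posetDensity P (Q n)) atTop (𝓝 l)

/-- `(S, μ, r)` is an ordered probability space: a probability space with a strict order relation
that is measurable for the product σ-algebra. -/
structure IsOrderedProbabilitySpace {S : Type*} [MeasurableSpace S] (μ : Measure S)
    (r : S → S → Prop) : Prop where
  isProbabilityMeasure : IsProbabilityMeasure μ
  isStrictOrder : IsStrictOrder S r
  measurableSet_rel : MeasurableSet {p : S × S | r p.1 p.2}

/-- `(S, μ, r, W)` is a poset kernel. -/
structure IsPosetKernel {S : Type*} [MeasurableSpace S] (μ : Measure S)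
    (r : S → S → Prop) (W : S → S → ℝ) : Prop where
  isOrderedProbabilitySpace : IsOrderedProbabilitySpace μ r
  measurable : Measurable (Function.uncurry W)
  mem_Icc : ∀ x y, W x y ∈ Set.Icc (0 : ℝ) 1
  rel_of_pos : ∀ x y, 0 < W x y → r x y
  eq_one_of_pos_of_pos : ∀ x y z, 0 < W x y → 0 < W y z → W x z = 1

open Classical in
/-- The density of a finite poset `P` in the kernel `W`: the integral over `(x_a)_{a ∈ P}`, with
respect to the product measure, of the product of `W x_a x_b` over all pairs `a < b` in `P`. -/
noncomputable def kernelDensity (P : Type*) [Fintype P] [PartialOrder P]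
    {S : Type*} [MeasurableSpace S] (μ : Measure S) (W : S → S → ℝ) : ℝ :=
  ∫ x : P → S, ∏ p : P × P with p.1 < p.2, W (x p.1) (x p.2) ∂(Measure.pi fun _ => μ)

/-!
The kernel is built as a limit of the posets and then rearranged until its order is that of `[0,1]`.

**A limit along an ultrafilter.** As the densities converge, it is enough to find a kernel whose
densities are their limits along a nonprincipal ultrafilter. Each vertex of `Q n` is given a type in
the compact metrizable space `VertexType`, whose coordinates are test functions. There is a countable
dense family of continuous kernels `c j`, the `j`-th one depending on the first `j` coordinates only
(`exists_dense_kernels`), so the `j`-th coordinate can be chosen as the pair of test functions that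
distinguishes `Q n` best from `c j` read through the types (`exists_vertexTypes`). The law of the
types of two random vertices, together with the weight of the pair, converges along the ultrafilter;
the limit kernel `W` is the conditional expectation of the weight given the types. If `c j` is close
to `W` in `L¹`, the limit law sees only a small difference from `c j` on the `j`-th coordinates, and
these are optimal for `Q n`, so `c j` is close in cut norm to most `Q n` too (`exists_isLimitKernel`).
By the counting lemma `abs_digraphDensity_sub_le`, densities pass to the limit.

**Order.** Transitivity and the absence of cycles are identities between densities of digraphs on
three vertices (`IsTransitiveInDensity`), hence they hold for `W`, up to null sets. Along an edge the
weight to any fixed set decreases and the weight from any fixed set increases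
(`ae_weight_monotone`). Recording the comparisons of these weights with rational numbers, for the
sets of a countable algebra, gives a real coordinate `h` that increases weakly along edges, and the
kernel is a function of the values of `h` (`exists_monotone_factor`). The quantile function of the law
of `h` then moves the kernel to `[0,1]` with Lebesgue measure. There an edge going down would lie
in an interval on which the kernel is a positive constant, and this would create cycles of positive
measure (`exists_ordered_kernel`).

**Null sets.** Keeping an edge only at density points of the set of edges, and giving it weight `1`
at density points of the set of edges of weight `1`, changes the kernel on a null set and makes it
transitive without exception, since density points compose (`IsDensityPoint.trans`,
`exists_isPosetKernel_ae_eq`).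
-/

/-! ### Digraph kernels, their densities, and the counting lemma -/

/-- A `[0,1]`-valued measurable function on `S × S`, seen as the edge weights of a digraph. -/
structure IsDigraphKernel {S : Type*} [MeasurableSpace S] (W : S → S → ℝ) : Prop where
  measurable : Measurable (Function.uncurry W)
  mem_Icc : ∀ x y, W x y ∈ Set.Icc (0 : ℝ) 1

/-- Density in the kernel `W` of the digraph with vertex set `V` and edge set `F`. -/
noncomputable def digraphDensity {V : Type*} [Fintype V] (F : Finset (V × V))
    {S : Type*} [MeasurableSpace S] (μ : Measure S) (W : S → S → ℝ) : ℝ :=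
  ∫ x : V → S, ∏ p ∈ F, W (x p.1) (x p.2) ∂(Measure.pi fun _ => μ)

/-- A digraph with no loops and at most one direction on each pair of vertices (`p = p.swap` is
the case of a loop). The counting lemma fails for kernels without this restriction. -/
def IsOriented {V : Type*} (F : Finset (V × V)) : Prop :=
  ∀ p ∈ F, p.swap ∉ F

section

variable {V : Type*} [Fintype V] [DecidableEq V] {S : Type*} [MeasurableSpace S]

lemma IsDigraphKernel.comp {T : Type*} [MeasurableSpace T] {W : T → T → ℝ}
    (hW : IsDigraphKernel W) {φ : S → T} (hφ : Measurable φ) :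
    IsDigraphKernel fun x y => W (φ x) (φ y) where
  measurable := hW.measurable.comp (hφ.prodMap hφ)
  mem_Icc _ _ := hW.mem_Icc _ _

lemma IsDigraphKernel.measurable_comp {T : Type*} [MeasurableSpace T] {W : T → T → ℝ}
    (hW : IsDigraphKernel W) {f g : S → T} (hf : Measurable f) (hg : Measurable g) :
    Measurable fun x => W (f x) (g x) :=
  hW.measurable.comp (hf.prodMk hg)

omit [Fintype V] in
lemma measurable_update_pair (a : V) :
    Measurable fun q : (V → S) × S => Function.update q.1 a q.2 := by
  refine measurable_pi_lambda _ fun i => ?_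
  by_cases h : i = a
  · subst h; simpa using measurable_snd
  · simpa [Function.update_of_ne h] using measurable_pi_iff.1 measurable_fst i

/-- Resampling one coordinate preserves a product of copies of a probability measure. -/
lemma measurePreserving_update (μ : Measure S) [IsProbabilityMeasure μ] (a : V) :
    MeasurePreserving (fun q : (V → S) × S => Function.update q.1 a q.2)
      ((Measure.pi fun _ => μ).prod μ) (Measure.pi fun _ => μ) := by
  refine ⟨measurable_update_pair a, (Measure.pi_eq fun A hA => ?_).symm⟩
  rw [Measure.map_apply (measurable_update_pair a) (MeasurableSet.univ_pi hA)]
  have : (fun q : (V → S) × S => Function.update q.1 a q.2) ⁻¹' Set.univ.pi A =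
      (Set.univ.pi (Function.update A a Set.univ)) ×ˢ A a := by
    ext ⟨x, s⟩
    simp only [Set.mem_preimage, Set.mem_pi, Set.mem_univ, true_implies, Set.mem_prod]
    constructor
    · intro h
      refine ⟨fun i => ?_, by simpa using h a⟩
      by_cases hi : i = a
      · subst hi; simp
      · simpa [hi] using h i
    · rintro ⟨h, h'⟩ i
      by_cases hi : i = a
      · subst hi; simpa using h'
      · simpa [hi] using h i
  rw [this, Measure.prod_prod, Measure.pi_pi, ← Finset.prod_erase_mul _ _ (Finset.mem_univ a),
    ← Finset.prod_erase_mul (Finset.univ) (fun i => μ (A i)) (Finset.mem_univ a)]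
  simp only [Function.update_self, measure_univ, mul_one]
  congr 1
  refine Finset.prod_congr rfl fun i hi => ?_
  rw [Function.update_of_ne (Finset.ne_of_mem_erase hi)]

lemma integral_pi_update (μ : Measure S) [IsProbabilityMeasure μ] (a b : V)
    {G : (V → S) → ℝ} (hG : Measurable G) (hb : ∃ C, ∀ x, ‖G x‖ ≤ C) :
    ∫ x, G x ∂(Measure.pi fun _ => μ) =
      ∫ x, ∫ s, ∫ t, G (Function.update (Function.update x a s) b t) ∂μ ∂μ
        ∂(Measure.pi fun _ => μ) := by
  obtain ⟨C, hC⟩ := hb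
  have h1 : ∀ (c : V) (G : (V → S) → ℝ), Measurable G → (∀ x, ‖G x‖ ≤ C) →
      ∫ x, G x ∂(Measure.pi fun _ => μ) =
        ∫ x, ∫ s, G (Function.update x c s) ∂μ ∂(Measure.pi fun _ => μ) := by
    intro c G hG hC
    rw [← (measurePreserving_update μ c).map_eq,
      integral_map (measurable_update_pair c).aemeasurable hG.aestronglyMeasurable,
      integral_prod, (measurePreserving_update μ c).map_eq]
    exact Integrable.of_bound (hG.comp (measurable_update_pair c)).aestronglyMeasurable C
      (ae_of_all _ fun x => hC _)
  have hm : Measurable fun q : (V → S) × S => G (Function.update q.1 b q.2) :=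
    hG.comp (measurable_update_pair b)
  rw [h1 b G hG hC, h1 a]
  · exact hm.stronglyMeasurable.integral_prod_right.measurable
  · intro x
    refine (norm_integral_le_of_norm_le_const (C := C) (ae_of_all _ fun t => hC _)).trans ?_
    simp

variable {μ : Measure S} [IsProbabilityMeasure μ]

lemma prod_mem_Icc {ι : Type*} (F : Finset ι) {f : ι → ℝ} (hf : ∀ i ∈ F, f i ∈ Set.Icc (0 : ℝ) 1) :
    ∏ i ∈ F, f i ∈ Set.Icc (0 : ℝ) 1 :=
  ⟨Finset.prod_nonneg fun i hi => (hf i hi).1,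
    Finset.prod_le_one (fun i hi => (hf i hi).1) fun i hi => (hf i hi).2⟩

/-- `f` and `g` differ by at most `ε` in cut norm. -/
def CutClose (μ : Measure S) (f g : S → S → ℝ) (ε : ℝ) : Prop :=
  ∀ u v : S → ℝ, Measurable u → Measurable v → (∀ x, u x ∈ Set.Icc (0 : ℝ) 1) →
    (∀ x, v x ∈ Set.Icc (0 : ℝ) 1) → |∫ x, ∫ y, (f x y - g x y) * (u x * v y) ∂μ ∂μ| ≤ ε

/-- Exchanging the weight of the single edge `p₀`: once the vertices other than the ends of `p₀` are
fixed, the remaining edges contribute a function of one end times a function of the other. -/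
lemma abs_integral_edge_le {f g : S → S → ℝ} (hf : IsDigraphKernel f) (hg : IsDigraphKernel g)
    {ε : ℝ} (hfg : CutClose μ f g ε) {F : Finset (V × V)} {p₀ : V × V} (hne : p₀.1 ≠ p₀.2)
    (hp : p₀ ∉ F) (hs : p₀.swap ∉ F) {H : V × V → S → S → ℝ} (hH : ∀ p, IsDigraphKernel (H p)) :
    |∫ x : V → S, (f (x p₀.1) (x p₀.2) - g (x p₀.1) (x p₀.2)) *
      ∏ p ∈ F, H p (x p.1) (x p.2) ∂(Measure.pi fun _ => μ)| ≤ ε := by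
  obtain ⟨a, b⟩ := p₀
  simp only [Prod.swap_prod_mk] at hne hp hs ⊢
  have hprod : ∀ F' : Finset (V × V),
      Measurable fun x : V → S => ∏ p ∈ F', H p (x p.1) (x p.2) := fun F' =>
    Finset.measurable_fun_prod _ fun p _ =>
      (hH p).measurable_comp (measurable_pi_apply _) (measurable_pi_apply _)
  have hprodI : ∀ (F' : Finset (V × V)) (x : V → S),
      ∏ p ∈ F', H p (x p.1) (x p.2) ∈ Set.Icc (0 : ℝ) 1 := fun F' x =>
    prod_mem_Icc _ fun p _ => (hH p).mem_Icc _ _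
  rw [integral_pi_update μ a b]
  rotate_left
  · exact ((hf.measurable_comp (measurable_pi_apply _) (measurable_pi_apply _)).sub
      (hg.measurable_comp (measurable_pi_apply _) (measurable_pi_apply _))).mul (hprod F)
  · refine ⟨1, fun x => ?_⟩
    have h1 := hf.mem_Icc (x a) (x b)
    have h2 := hg.mem_Icc (x a) (x b)
    have h3 := hprodI F x
    rw [norm_mul, Real.norm_eq_abs, Real.norm_eq_abs]
    refine mul_le_one₀ ?_ (abs_nonneg _) ?_
    · rw [abs_le]; constructor <;> linarith [h1.1, h1.2, h2.1, h2.2]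
    · rw [abs_of_nonneg h3.1]; exact h3.2
  rw [← Real.norm_eq_abs]
  refine le_trans (norm_integral_le_of_norm_le_const (C := ε) (ae_of_all _ fun x => ?_)) (by simp)
  rw [Real.norm_eq_abs]
  set P : V × V → Prop := fun p => p.1 = a ∨ p.2 = a with hP
  have key := hfg (fun s => ∏ p ∈ F with P p,
      H p (Function.update x a s p.1) (Function.update x a s p.2))
    (fun t => ∏ p ∈ F with ¬ P p,
      H p (Function.update x b t p.1) (Function.update x b t p.2))
    ((hprod _).comp (measurable_update x (a := a)))
    ((hprod _).comp (measurable_update x (a := b)))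
    (fun s => hprodI _ _) (fun t => hprodI _ _)
  convert key using 2
  refine integral_congr_ae (ae_of_all _ fun s => integral_congr_ae (ae_of_all _ fun t => ?_))
  simp only [Function.update_self, Function.update_of_ne hne]
  congr 1
  rw [← Finset.prod_filter_mul_prod_filter_not F P]
  congr 1
  · refine Finset.prod_congr rfl fun p hpF => ?_
    rw [Finset.mem_filter] at hpF
    have h1 : p.1 ≠ b ∧ p.2 ≠ b := by
      obtain ⟨p1, p2⟩ := p
      rcases hpF with ⟨hm, rfl | rfl⟩
      · exact ⟨hne, fun h => hp (h ▸ hm)⟩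
      · exact ⟨fun h => hs (h ▸ hm), hne⟩
    rw [Function.update_of_ne h1.1, Function.update_of_ne h1.2]
  · refine Finset.prod_congr rfl fun p hpF => ?_
    rw [Finset.mem_filter, hP, not_or] at hpF
    have h2 : ∀ i : V, i ≠ a → Function.update (Function.update x a s) b t i =
        Function.update x b t i := by
      intro i hi
      by_cases hb : i = b
      · subst hb; simp
      · simp [hb, hi]
    rw [h2 _ hpF.2.1, h2 _ hpF.2.2]

/-- The counting lemma: the densities of an oriented digraph in kernels that are close in cut norm
are close. -/
lemma abs_digraphDensity_sub_le {f g : S → S → ℝ} (hf : IsDigraphKernel f)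
    (hg : IsDigraphKernel g) {ε : ℝ} (hfg : CutClose μ f g ε) {F : Finset (V × V)}
    (hF : IsOriented F) :
    |digraphDensity F μ f - digraphDensity F μ g| ≤ F.card * ε := by
  -- the hybrid density, with weight `g` on the edges in `A` and `f` on the others
  let H : Finset (V × V) → V × V → S → S → ℝ := fun A p => if p ∈ A then g else f
  let D : Finset (V × V) → ℝ := fun A =>
    ∫ x : V → S, ∏ p ∈ F, H A p (x p.1) (x p.2) ∂(Measure.pi fun _ => μ)
  have hH : ∀ A p, IsDigraphKernel (H A p) := fun A p => by
    by_cases h : p ∈ A <;> simpa [H, h]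
  have hint : ∀ A, Integrable (fun x : V → S => ∏ p ∈ F, H A p (x p.1) (x p.2))
      (Measure.pi fun _ => μ) := fun A => by
    refine Integrable.of_bound (C := 1) (Finset.measurable_fun_prod _ fun p _ =>
      (hH A p).measurable_comp (measurable_pi_apply _)
        (measurable_pi_apply _)).aestronglyMeasurable (ae_of_all _ fun x => ?_)
    have := prod_mem_Icc F fun p _ => (hH A p).mem_Icc (x p.1) (x p.2)
    rw [Real.norm_eq_abs, abs_of_nonneg this.1]; exact this.2
  have main : ∀ A ⊆ F, |digraphDensity F μ f - D A| ≤ A.card * ε := by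
    intro A
    induction A using Finset.induction_on with
    | empty => intro _; simp [D, H, digraphDensity]
    | insert p₀ A hp₀ ih =>
      intro hA
      have hmem : p₀ ∈ F := hA (Finset.mem_insert_self _ _)
      have step : |D A - D (insert p₀ A)| ≤ ε := by
        have h := abs_integral_edge_le hf hg hfg (F := F.erase p₀) (p₀ := p₀) (H := H A)
          (fun h => hF p₀ hmem (by rwa [show p₀.swap = p₀ from Prod.ext h.symm h]))
          (Finset.notMem_erase _ _)
          (fun h => hF p₀ hmem (Finset.mem_of_mem_erase h)) (hH A)
        rw [← integral_sub (hint _) (hint _)]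
        convert h using 3
        ext x
        rw [← Finset.mul_prod_erase F _ hmem, ← Finset.mul_prod_erase F _ hmem, sub_mul]
        congr 2
        · simp [H, hp₀]
        · simp [H]
        · refine Finset.prod_congr rfl fun p hp => ?_
          simp [H, Finset.ne_of_mem_erase hp]
      have := ih ((Finset.subset_insert _ _).trans hA)
      rw [Finset.card_insert_of_notMem hp₀]
      push_cast
      calc _ ≤ |digraphDensity F μ f - D A| + |D A - D (insert p₀ A)| := abs_sub_le _ _ _
        _ ≤ _ := by linarith
  have h := main F subset_rfl
  have hD : D F = digraphDensity F μ g := by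
    refine integral_congr_ae (ae_of_all _ fun x => Finset.prod_congr rfl fun p hp => ?_)
    simp [H, hp]
  rwa [hD] at h

omit [DecidableEq V] [IsProbabilityMeasure μ] in
lemma digraphDensity_map {T : Type*} [MeasurableSpace T] {ν : Measure T}
    [IsProbabilityMeasure μ] [IsProbabilityMeasure ν] {φ : S → T} (hφ : MeasurePreserving φ μ ν)
    {W : T → T → ℝ} (hW : IsDigraphKernel W) (F : Finset (V × V)) :
    digraphDensity F μ (fun x y => W (φ x) (φ y)) = digraphDensity F ν W := by
  have h := measurePreserving_pi (fun _ : V => μ) (fun _ : V => ν) (fun _ => hφ)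
  unfold digraphDensity
  rw [← h.map_eq, integral_map h.measurable.aemeasurable]
  exact (Finset.measurable_fun_prod _ fun p _ => hW.measurable_comp
    (measurable_pi_apply _) (measurable_pi_apply _)).aestronglyMeasurable

omit [IsProbabilityMeasure μ] in
lemma CutClose.of_integral_abs [IsFiniteMeasure μ] {f g : S → S → ℝ} (hf : IsDigraphKernel f)
    (hg : IsDigraphKernel g)
    {ε : ℝ} (h : ∫ p, |f p.1 p.2 - g p.1 p.2| ∂(μ.prod μ) ≤ ε) : CutClose μ f g ε := by
  intro u v hu hv hu1 hv1
  have hb : ∀ p : S × S, ‖f p.1 p.2 - g p.1 p.2‖ ≤ 1 := fun p => by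
    have h1 := hf.mem_Icc p.1 p.2
    have h2 := hg.mem_Icc p.1 p.2
    rw [Real.norm_eq_abs, abs_le]; constructor <;> linarith [h1.1, h1.2, h2.1, h2.2]
  have hint : Integrable (fun p : S × S => f p.1 p.2 - g p.1 p.2) (μ.prod μ) :=
    Integrable.of_bound (hf.measurable.sub hg.measurable).aestronglyMeasurable 1
      (ae_of_all _ hb)
  have hle : ∀ p : S × S, ‖(f p.1 p.2 - g p.1 p.2) * (u p.1 * v p.2)‖ ≤
      |f p.1 p.2 - g p.1 p.2| := fun p => by
    rw [norm_mul, Real.norm_eq_abs]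
    refine mul_le_of_le_one_right (abs_nonneg _) ?_
    rw [Real.norm_eq_abs, abs_of_nonneg (mul_nonneg (hu1 _).1 (hv1 _).1)]
    exact mul_le_one₀ (hu1 _).2 (hv1 _).1 (hv1 _).2
  have hint2 : Integrable (fun p : S × S => (f p.1 p.2 - g p.1 p.2) * (u p.1 * v p.2))
      (μ.prod μ) :=
    hint.abs.mono' ((hf.measurable.sub hg.measurable).mul
      ((hu.comp measurable_fst).mul (hv.comp measurable_snd))).aestronglyMeasurable
      (ae_of_all _ hle)
  rw [← integral_prod _ hint2]
  refine le_trans ?_ h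
  exact norm_integral_le_of_norm_le hint.abs (ae_of_all _ hle)

lemma digraphDensity_congr_ae {f g : S → S → ℝ} (hf : IsDigraphKernel f)
    (hg : IsDigraphKernel g) (h : ∀ᵐ p ∂(μ.prod μ), f p.1 p.2 = g p.1 p.2) {F : Finset (V × V)}
    (hF : IsOriented F) : digraphDensity F μ f = digraphDensity F μ g := by
  have h0 : CutClose μ f g 0 := .of_integral_abs hf hg <| le_of_eq <|
    integral_eq_zero_of_ae <| h.mono fun p hp => by simp [hp]
  have := abs_digraphDensity_sub_le hf hg h0 hF
  rw [mul_zero] at this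
  linarith [abs_nonpos_iff.1 this]

/-! ### Densities of digraphs on three vertices -/

/-- The edges `0 → 1 → 2`. -/
def pathEdges : Finset (Fin 3 × Fin 3) := {(0, 1), (1, 2)}

/-- The edges `0 → 1 → 2` and `0 → 2` of the three-element chain. -/
def chainEdges : Finset (Fin 3 × Fin 3) := {(0, 1), (1, 2), (0, 2)}

/-- The edges `0 → 1 → 2 → 0`. -/
def cycleEdges : Finset (Fin 3 × Fin 3) := {(0, 1), (1, 2), (2, 0)}

lemma isOriented_pathEdges : IsOriented pathEdges := by unfold IsOriented; decide

lemma isOriented_chainEdges : IsOriented chainEdges := by unfold IsOriented; decide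

lemma isOriented_cycleEdges : IsOriented cycleEdges := by unfold IsOriented; decide

lemma prod_pathEdges {M : Type*} [CommMonoid M] (φ : Fin 3 × Fin 3 → M) :
    ∏ p ∈ pathEdges, φ p = φ (0, 1) * φ (1, 2) := by
  rw [pathEdges, Finset.prod_pair (by decide)]

lemma prod_chainEdges {M : Type*} [CommMonoid M] (φ : Fin 3 × Fin 3 → M) :
    ∏ p ∈ chainEdges, φ p = φ (0, 1) * φ (1, 2) * φ (0, 2) := by
  rw [chainEdges, Finset.prod_insert (by decide), Finset.prod_pair (by decide), mul_assoc]

lemma prod_cycleEdges {M : Type*} [CommMonoid M] (φ : Fin 3 × Fin 3 → M) :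
    ∏ p ∈ cycleEdges, φ p = φ (0, 1) * φ (1, 2) * φ (2, 0) := by
  rw [cycleEdges, Finset.prod_insert (by decide), Finset.prod_pair (by decide), mul_assoc]

lemma measurePreserving_vec3 (μ : Measure S) [IsProbabilityMeasure μ] :
    MeasurePreserving (fun t : S × S × S => (![t.1, t.2.1, t.2.2] : Fin 3 → S))
      (μ.prod (μ.prod μ)) (Measure.pi fun _ => μ) := by
  have hm : Measurable (fun t : S × S × S => (![t.1, t.2.1, t.2.2] : Fin 3 → S)) := by
    refine measurable_pi_lambda _ fun i => ?_
    fin_cases i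
    · exact measurable_fst
    · exact measurable_snd.fst
    · exact measurable_snd.snd
  refine ⟨hm, (Measure.pi_eq fun A hA => ?_).symm⟩
  rw [Measure.map_apply hm (MeasurableSet.univ_pi hA)]
  have : (fun t : S × S × S => (![t.1, t.2.1, t.2.2] : Fin 3 → S)) ⁻¹' Set.univ.pi A =
      A 0 ×ˢ (A 1 ×ˢ A 2) := by
    ext ⟨x, y, z⟩
    simp [Set.mem_pi, Fin.forall_fin_succ]
  rw [this, Measure.prod_prod, Measure.prod_prod, Fin.prod_univ_three, mul_assoc]

lemma digraphDensity_fin_three {W : S → S → ℝ} (hW : IsDigraphKernel W)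
    (F : Finset (Fin 3 × Fin 3)) :
    digraphDensity F μ W = ∫ t : S × S × S, ∏ p ∈ F,
      W ((![t.1, t.2.1, t.2.2] : Fin 3 → S) p.1) ((![t.1, t.2.1, t.2.2] : Fin 3 → S) p.2)
        ∂(μ.prod (μ.prod μ)) := by
  rw [digraphDensity, ← (measurePreserving_vec3 μ).map_eq,
    integral_map (measurePreserving_vec3 μ).measurable.aemeasurable]
  exact (Finset.measurable_fun_prod _ fun p _ => hW.measurable_comp
    (measurable_pi_apply _) (measurable_pi_apply _)).aestronglyMeasurable

lemma integrable_triple {W : S → S → ℝ} (hW : IsDigraphKernel W) (F : Finset (Fin 3 × Fin 3)) :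
    Integrable (fun t : S × S × S => ∏ p ∈ F,
      W ((![t.1, t.2.1, t.2.2] : Fin 3 → S) p.1) ((![t.1, t.2.1, t.2.2] : Fin 3 → S) p.2))
        (μ.prod (μ.prod μ)) := by
  refine Integrable.of_bound (C := 1) (Finset.measurable_fun_prod _ fun p _ => hW.measurable_comp
    ((measurable_pi_apply _).comp (measurePreserving_vec3 μ).measurable)
    ((measurable_pi_apply _).comp
      (measurePreserving_vec3 μ).measurable)).aestronglyMeasurable (ae_of_all _ fun t => ?_)
  have := prod_mem_Icc F fun p _ => hW.mem_Icc
    ((![t.1, t.2.1, t.2.2] : Fin 3 → S) p.1) ((![t.1, t.2.1, t.2.2] : Fin 3 → S) p.2)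
  rw [Real.norm_eq_abs, abs_of_nonneg this.1]; exact this.2

/-- A kernel behaving like a strict order as far as densities of three-vertex digraphs can see. -/
structure IsTransitiveInDensity (μ : Measure S) (W : S → S → ℝ) : Prop where
  path_eq_chain : digraphDensity pathEdges μ W = digraphDensity chainEdges μ W
  cycle_eq_zero : digraphDensity cycleEdges μ W = 0

lemma IsTransitiveInDensity.ae_eq_one {W : S → S → ℝ} (hW : IsDigraphKernel W)
    (h : IsTransitiveInDensity μ W) :
    ∀ᵐ t : S × S × S ∂(μ.prod (μ.prod μ)),
      0 < W t.1 t.2.1 → 0 < W t.2.1 t.2.2 → W t.1 t.2.2 = 1 := by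
  have h0 := sub_eq_zero.2 h.path_eq_chain
  rw [digraphDensity_fin_three hW, digraphDensity_fin_three hW,
    ← integral_sub (integrable_triple hW _) (integrable_triple hW _)] at h0
  replace h0 := (integral_eq_zero_iff_of_nonneg ?_
    ((integrable_triple hW pathEdges).sub (integrable_triple hW chainEdges))).1 h0
  · filter_upwards [h0] with t ht h1 h2
    simp only [Pi.sub_apply, prod_pathEdges, prod_chainEdges, Pi.zero_apply, Matrix.cons_val] at ht
    have : W t.1 t.2.1 * W t.2.1 t.2.2 * (1 - W t.1 t.2.2) = 0 := by linarith
    have h3 := (mul_eq_zero.1 this).resolve_left (mul_pos h1 h2).ne'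
    linarith
  · intro t
    simp only [Pi.sub_apply, prod_pathEdges, prod_chainEdges, Pi.zero_apply, Matrix.cons_val]
    have h1 := hW.mem_Icc t.1 t.2.1
    have h2 := hW.mem_Icc t.2.1 t.2.2
    have h3 := hW.mem_Icc t.1 t.2.2
    exact sub_nonneg.2 (mul_le_of_le_one_right (mul_nonneg h1.1 h2.1) h3.2)

lemma IsTransitiveInDensity.ae_not_cycle {W : S → S → ℝ} (hW : IsDigraphKernel W)
    (h : IsTransitiveInDensity μ W) :
    ∀ᵐ t : S × S × S ∂(μ.prod (μ.prod μ)),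
      ¬ (0 < W t.1 t.2.1 ∧ 0 < W t.2.1 t.2.2 ∧ 0 < W t.2.2 t.1) := by
  have h0 := h.cycle_eq_zero
  rw [digraphDensity_fin_three hW, integral_eq_zero_iff_of_nonneg _ (integrable_triple hW _)] at h0
  · filter_upwards [h0] with t ht ⟨h1, h2, h3⟩
    simp only [prod_cycleEdges, Pi.zero_apply, Matrix.cons_val] at ht
    exact (mul_pos (mul_pos h1 h2) h3).ne' ht
  · intro t
    exact Finset.prod_nonneg fun p _ => (hW.mem_Icc _ _).1

end

/-! ### A countable dense family of continuous kernels on the space of types -/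

/-- The space of types of vertices. A type is a sequence of pairs of weights in `[0,1]`; the first
weight of each pair is used for a vertex in the role of a source, the second for a target. -/
abbrev VertexType : Type := ℕ → unitInterval × unitInterval

/-- Forget the coordinates from `j` on. -/
def VertexType.truncate (j : ℕ) (x : VertexType) : VertexType := fun i => if i < j then x i else 0

lemma VertexType.continuous_truncate (j : ℕ) : Continuous (truncate j) := by
  refine continuous_pi fun i => ?_
  unfold truncate
  split_ifs
  · exact continuous_apply i
  · exact continuous_const

lemma VertexType.tendsto_truncate {φ : ℕ → ℕ} (hφ : Tendsto φ atTop atTop) (x : VertexType) :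
    Tendsto (fun k => truncate (φ k) x) atTop (𝓝 x) := by
  refine tendsto_pi_nhds.2 fun i => tendsto_const_nhds.congr' ?_
  filter_upwards [hφ.eventually_gt_atTop i] with k hk
  simp [truncate, hk]

lemma VertexType.truncate_congr {j : ℕ} {x x' : VertexType} (h : ∀ i < j, x i = x' i) :
    truncate j x = truncate j x' := by
  ext1 i
  unfold truncate
  split_ifs with hi
  · exact h i hi
  · rfl

lemma abs_max_min_sub_le {a w : ℝ} (hw : w ∈ Set.Icc (0 : ℝ) 1) :
    |w - max 0 (min 1 a)| ≤ |w - a| := by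
  obtain ⟨h0, h1⟩ := hw
  rcases le_total a 0 with h | h
  · rw [max_eq_left ((min_le_right _ _).trans h), sub_zero, abs_of_nonneg h0,
      abs_of_nonneg (by linarith)]
    linarith
  · rw [max_eq_right (le_min zero_le_one h)]
    rcases le_total a 1 with h' | h'
    · rw [min_eq_right h']
    · rw [min_eq_left h', abs_of_nonpos (by linarith), abs_of_nonpos (by linarith)]
      linarith

/-- A countable family of continuous kernels, the `j`-th one depending only on the first `j`
coordinates, that is dense in `L¹` for every law on pairs of types. -/
lemma exists_dense_kernels : ∃ c : ℕ → VertexType → VertexType → ℝ,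
    (∀ j, Continuous (Function.uncurry (c j))) ∧ (∀ j x y, c j x y ∈ Set.Icc (0 : ℝ) 1) ∧
    (∀ j x y x' y', (∀ i < j, x i = x' i) → (∀ i < j, y i = y' i) → c j x y = c j x' y') ∧
    ∀ (π : Measure (VertexType × VertexType)) [IsProbabilityMeasure π]
      (W : VertexType → VertexType → ℝ), IsDigraphKernel W → ∀ ε > 0,
      ∃ j, ∫ p, |W p.1 p.2 - c j p.1 p.2| ∂π ≤ ε := by
  let g : ℕ → C(VertexType × VertexType, ℝ) := TopologicalSpace.denseSeq _
  let c : ℕ → VertexType → VertexType → ℝ := fun j x y =>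
    max 0 (min 1 (g j.unpair.1 (VertexType.truncate j x, VertexType.truncate j y)))
  have hcont : ∀ j, Continuous (Function.uncurry (c j)) := fun j => by
    have := ((VertexType.continuous_truncate j).prodMap (VertexType.continuous_truncate j))
    exact continuous_const.max (continuous_const.min ((g _).continuous.comp this))
  have hI : ∀ j x y, c j x y ∈ Set.Icc (0 : ℝ) 1 := fun j x y =>
    ⟨le_max_left _ _, max_le zero_le_one (min_le_left _ _)⟩
  refine ⟨c, hcont, hI, fun j x y x' y' hx hy => ?_, fun π _ W hW ε hε => ?_⟩
  · simp only [c, VertexType.truncate_congr hx, VertexType.truncate_congr hy]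
  · have : π.WeaklyRegular :=
      Measure.WeaklyRegular.of_pseudoMetrizableSpace_of_isFiniteMeasure _
    have hWint : Integrable (fun p : VertexType × VertexType => W p.1 p.2) π :=
      Integrable.of_bound hW.measurable.aestronglyMeasurable 1 (ae_of_all _ fun p => by
        rw [Real.norm_eq_abs, abs_of_nonneg (hW.mem_Icc _ _).1]; exact (hW.mem_Icc _ _).2)
    obtain ⟨g₀, hg₀, hg₀int⟩ :=
      hWint.exists_boundedContinuous_integral_sub_le (half_pos (half_pos hε))
    obtain ⟨i, hi⟩ := (TopologicalSpace.denseRange_denseSeq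
      C(VertexType × VertexType, ℝ)).exists_dist_lt g₀.toContinuousMap (half_pos (half_pos hε))
    have hgi : ∀ p, |g₀ p - g i p| ≤ ε / 2 / 2 := fun p => by
      have := (ContinuousMap.dist_apply_le_dist p).trans hi.le
      rwa [Real.dist_eq] at this
    set L : VertexType × VertexType → ℝ := fun p => max 0 (min 1 (g i p)) with hL
    have hLcont : Continuous L := continuous_const.max (continuous_const.min (g i).continuous)
    have hbound : ∀ w ∈ Set.Icc (0 : ℝ) 1, ∀ z ∈ Set.Icc (0 : ℝ) 1, |w - z| ≤ 1 := by
      intro w hw z hz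
      rw [abs_le]; constructor <;> linarith [hw.1, hw.2, hz.1, hz.2]
    have h1 : ∫ p, |W p.1 p.2 - L p| ∂π ≤ ε / 2 := by
      calc ∫ p, |W p.1 p.2 - L p| ∂π ≤ ∫ p, (|W p.1 p.2 - g₀ p| + ε / 2 / 2) ∂π := by
            refine integral_mono_of_nonneg (ae_of_all _ fun p => abs_nonneg _)
              ((hWint.sub hg₀int).abs.add (integrable_const _)) (ae_of_all _ fun p => ?_)
            calc |W p.1 p.2 - L p| ≤ |W p.1 p.2 - g i p| := abs_max_min_sub_le (hW.mem_Icc _ _)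
              _ ≤ |W p.1 p.2 - g₀ p| + |g₀ p - g i p| := abs_sub_le _ _ _
              _ ≤ _ := by linarith [hgi p]
        _ = ∫ p, |W p.1 p.2 - g₀ p| ∂π + ε / 2 / 2 := by
            have hd : Integrable (fun p => |W p.1 p.2 - g₀ p|) π := (hWint.sub hg₀int).abs
            rw [integral_add hd (integrable_const _)]; simp
        _ ≤ ε / 2 := by
            have : ∫ p, |W p.1 p.2 - g₀ p| ∂π ≤ ε / 2 / 2 := hg₀
            linarith
    have h2 : Tendsto (fun k => ∫ p, |W p.1 p.2 - c (Nat.pair i k) p.1 p.2| ∂π) atTop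
        (𝓝 (∫ p, |W p.1 p.2 - L p| ∂π)) := by
      refine tendsto_integral_of_dominated_convergence (fun _ => 1) (fun k => ?_)
        (integrable_const _) (fun k => ae_of_all _ fun p => ?_) (ae_of_all _ fun p => ?_)
      · exact (hW.measurable.sub (hcont _).measurable).abs.aestronglyMeasurable
      · rw [Real.norm_eq_abs, abs_abs]
        exact hbound _ (hW.mem_Icc _ _) _ (hI _ _ _)
      · have hφ : Tendsto (fun k => Nat.pair i k) atTop atTop :=
          tendsto_atTop_mono (fun k => Nat.right_le_pair i k) tendsto_id
        have ht := (hLcont.tendsto p).comp ((VertexType.tendsto_truncate hφ p.1).prodMk_nhds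
          (VertexType.tendsto_truncate hφ p.2))
        refine (tendsto_const_nhds.sub (ht.congr fun k => ?_)).abs
        simp [c, hL]
    obtain ⟨k, hk⟩ := (h2.eventually_le_const (show _ < ε by linarith)).exists
    exact ⟨_, hk⟩

/-! ### Types of the vertices of a finite weighted digraph -/

/-- Among all pairs of test functions on a finite space, some pair detects a given weight function
best. -/
lemma exists_optimal_test {Q : Type*} [Fintype Q] [MeasurableSpace Q] [DiscreteMeasurableSpace Q]
    (m : Measure Q) [IsFiniteMeasure m] (k : Q → Q → ℝ) :
    ∃ a : Q → unitInterval × unitInterval, ∀ b : Q → unitInterval × unitInterval,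
      |∫ x, ∫ y, k x y * ((b x).1 * (b y).2) ∂m ∂m| ≤
        |∫ x, ∫ y, k x y * ((a x).1 * (a y).2) ∂m ∂m| := by
  have hc : Continuous fun b : Q → unitInterval × unitInterval =>
      |∫ x, ∫ y, k x y * ((b x).1 * (b y).2) ∂m ∂m| := by
    simp only [integral_fintype Integrable.of_finite]
    fun_prop
  obtain ⟨a, -, ha⟩ := isCompact_univ.exists_isMaxOn Set.univ_nonempty hc.continuousOn
  exact ⟨a, fun b => ha (Set.mem_univ b)⟩

/-- Types can be given to the vertices of a finite weighted digraph such that the `j`-th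
coordinate best detects the difference from `c j`. As `c j` looks only at the first `j`
coordinates, the coordinates can be chosen one after the other. -/
lemma exists_vertexTypes {Q : Type*} [Fintype Q] [MeasurableSpace Q] [DiscreteMeasurableSpace Q]
    (m : Measure Q) [IsFiniteMeasure m] (f : Q → Q → ℝ)
    (c : ℕ → VertexType → VertexType → ℝ)
    (hc : ∀ j x y x' y', (∀ i < j, x i = x' i) → (∀ i < j, y i = y' i) →
      c j x y = c j x' y') :
    ∃ τ : Q → VertexType, ∀ j (b : Q → unitInterval × unitInterval),
      |∫ x, ∫ y, (f x y - c j (τ x) (τ y)) * ((b x).1 * (b y).2) ∂m ∂m| ≤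
        |∫ x, ∫ y, (f x y - c j (τ x) (τ y)) * ((τ x j).1 * (τ y j).2) ∂m ∂m| := by
  choose opt hopt using exists_optimal_test m
  -- the first `j` coordinates, filled up with zeros
  let s : ℕ → Q → VertexType := fun j => Nat.rec (fun _ => 0)
    (fun j σ x => Function.update (σ x) j (opt (fun x y => f x y - c j (σ x) (σ y)) x)) j
  have hs : ∀ j x, s (j + 1) x =
      Function.update (s j x) j (opt (fun x y => f x y - c j (s j x) (s j y)) x) := fun _ _ => rfl
  have hstable : ∀ i j, i < j → ∀ x, s j x i = s (i + 1) x i := by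
    intro i j hij x
    induction j, hij using Nat.le_induction with
    | base => rfl
    | succ j hij ih => rw [hs, Function.update_of_ne (by omega), ih]
  refine ⟨fun x i => s (i + 1) x i, fun j b => ?_⟩
  have h1 : ∀ x y, c j (fun i => s (i + 1) x i) (fun i => s (i + 1) y i) = c j (s j x) (s j y) :=
    fun x y => hc _ _ _ _ _ (fun i hi => (hstable i j hi x).symm)
      (fun i hi => (hstable i j hi y).symm)
  simp only [h1]
  have h2 : ∀ x, s (j + 1) x j = opt (fun x y => f x y - c j (s j x) (s j y)) x := fun x => by
    rw [hs, Function.update_self]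
  simp only [h2]
  exact hopt _ b

/-! ### Limit kernels of sequences of finite weighted digraphs -/

section

variable {Q : ℕ → Type*} [∀ n, Fintype (Q n)] [∀ n, MeasurableSpace (Q n)]
  [∀ n, DiscreteMeasurableSpace (Q n)]

/-- The kernel `W` on `(VertexType, μ)` is a limit along `𝒰` of the finite weighted digraphs `f n`
whose vertices have types `τ n`: the laws of the types converge to `μ`, and `W` is approximated by
continuous kernels which, read through the types, are close in cut norm to the digraphs. -/
structure IsLimitKernel (𝒰 : Ultrafilter ℕ) (m : ∀ n, ProbabilityMeasure (Q n))
    (f : ∀ n, Q n → Q n → unitInterval) (τ : ∀ n, Q n → VertexType)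
    (μ : ProbabilityMeasure VertexType) (W : VertexType → VertexType → ℝ) : Prop where
  isDigraphKernel : IsDigraphKernel W
  tendsto_law :
    Tendsto (fun n => (m n).map (Measurable.of_discrete (f := τ n)).aemeasurable) 𝒰 (𝓝 μ)
  exists_approx : ∀ ε > 0, ∃ c : VertexType → VertexType → ℝ, IsDigraphKernel c ∧
    Continuous (Function.uncurry c) ∧ CutClose (μ : Measure VertexType) W c ε ∧
    ∀ᶠ n in 𝒰, CutClose (m n : Measure (Q n)) (fun x y => (f n x y : ℝ))
      (fun x y => c (τ n x) (τ n y)) ε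

/-- Existence of limits: by compactness, the law of the types of two random vertices together with
the weight between them converges along `𝒰`, and the limit kernel is the expected weight given the
two types. A continuous kernel of the dense family that is close to the limit in `L¹` is close to
the digraphs in cut norm, since the best test functions against it are coordinates of the types. -/
lemma exists_isLimitKernel (𝒰 : Ultrafilter ℕ) (m : ∀ n, ProbabilityMeasure (Q n))
    (f : ∀ n, Q n → Q n → unitInterval) : ∃ τ μ W, IsLimitKernel 𝒰 m f τ μ W := by
  obtain ⟨c, hcont, hcI, hcongr, hdense⟩ := exists_dense_kernels
  have hcker : ∀ j, IsDigraphKernel (c j) := fun j => ⟨(hcont j).measurable, hcI j⟩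
  choose τ hτ using fun n =>
    exists_vertexTypes (m n : Measure (Q n)) (fun x y => (f n x y : ℝ)) c hcongr
  -- the law of the types of a random pair of vertices together with the weight of the pair
  let φ : ∀ n, Q n × Q n → (VertexType × VertexType) × unitInterval :=
    fun n p => ((τ n p.1, τ n p.2), f n p.1 p.2)
  have hφ : ∀ n, Measurable (φ n) := fun n => Measurable.of_discrete
  let law : ℕ → ProbabilityMeasure ((VertexType × VertexType) × unitInterval) :=
    fun n => ((m n).prod (m n)).map (hφ n).aemeasurable
  let law₁ : ℕ → ProbabilityMeasure VertexType :=
    fun n => (m n).map (Measurable.of_discrete (f := τ n)).aemeasurable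
  obtain ⟨ρ, -, hρ⟩ := isCompact_univ.ultrafilter_le_nhds (𝒰.map law) (by simp)
  obtain ⟨μ, -, hμ⟩ := isCompact_univ.ultrafilter_le_nhds (𝒰.map law₁) (by simp)
  replace hρ : Tendsto law 𝒰 (𝓝 ρ) := hρ
  replace hμ : Tendsto law₁ 𝒰 (𝓝 μ) := hμ
  have hfst : (ρ : Measure ((VertexType × VertexType) × unitInterval)).fst =
      (μ : Measure VertexType).prod (μ : Measure VertexType) := by
    have : T2Space (ProbabilityMeasure (VertexType × VertexType)) := ProbabilityMeasure.t2Space _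
    have h1 : Tendsto (fun n => (law n).map measurable_fst.aemeasurable) 𝒰
        (𝓝 (ρ.map measurable_fst.aemeasurable)) :=
      ProbabilityMeasure.tendsto_map_of_tendsto_of_continuous _ _ hρ continuous_fst
    have h2 : Tendsto (fun n => (law₁ n).prod (law₁ n)) 𝒰 (𝓝 (μ.prod μ)) :=
      (ProbabilityMeasure.continuous_prod.tendsto (μ, μ)).comp (hμ.prodMk_nhds hμ)
    have h3 : ∀ n, (law n).map measurable_fst.aemeasurable = (law₁ n).prod (law₁ n) := by
      intro n
      rw [ProbabilityMeasure.map_prod_map _ _ Measurable.of_discrete Measurable.of_discrete]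
      apply Subtype.ext
      simp only [ProbabilityMeasure.val_eq_to_measure, ProbabilityMeasure.toMeasure_map, law]
      rw [Measure.map_map measurable_fst (hφ n)]
      rfl
    simp only [h3] at h1
    exact congrArg ProbabilityMeasure.toMeasure (tendsto_nhds_unique h1 h2)
  -- the limit kernel is the expected weight given the types
  let W : VertexType → VertexType → ℝ := fun x y =>
    ∫ r : unitInterval, (r : ℝ) ∂((ρ : Measure _).condKernel (x, y))
  have hW : IsDigraphKernel W := by
    refine ⟨?_, fun x y => ⟨integral_nonneg fun r => r.2.1, ?_⟩⟩
    · have h : StronglyMeasurable fun q : (VertexType × VertexType) × unitInterval =>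
          (q.2 : ℝ) := (measurable_subtype_coe.comp measurable_snd).stronglyMeasurable
      exact (h.integral_kernel_prod_right' (κ := (ρ : Measure _).condKernel)).measurable
    · have := norm_integral_le_of_norm_le_const (μ := (ρ : Measure _).condKernel (x, y))
        (f := fun r : unitInterval => (r : ℝ)) (C := 1) (ae_of_all _ fun r => by
          rw [Real.norm_eq_abs, abs_of_nonneg r.2.1]; exact r.2.2)
      simpa using (le_abs_self _).trans this
  refine ⟨τ, μ, W, hW, hμ, fun ε hε => ?_⟩
  obtain ⟨j, hj⟩ := hdense ((μ : Measure VertexType).prod (μ : Measure VertexType)) W hW (ε / 2)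
    (half_pos hε)
  have hcut : ∀ δ ≥ ε / 2, CutClose (μ : Measure VertexType) W (c j) δ := fun δ hδ =>
    .of_integral_abs hW (hcker j) (hj.trans hδ)
  refine ⟨c j, hcker j, hcont j, hcut ε (by linarith), ?_⟩
  let a : VertexType → ℝ := fun x => (x j).1
  let b : VertexType → ℝ := fun x => (x j).2
  have ha : Continuous a := by fun_prop
  have hb : Continuous b := by fun_prop
  -- the best test functions at level `j` are functions of the types
  let D : C((VertexType × VertexType) × unitInterval, ℝ) :=
    ⟨fun q => ((q.2 : ℝ) - c j q.1.1 q.1.2) * (a q.1.1 * b q.1.2), by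
      have := (hcont j).comp (continuous_fst (X := VertexType × VertexType) (Y := unitInterval))
      exact ((continuous_subtype_val.comp continuous_snd).sub this).mul
        ((ha.comp continuous_fst.fst).mul (hb.comp continuous_fst.snd))⟩
  have hD : Tendsto (fun n => ∫ q, D q ∂(law n : Measure _)) 𝒰
      (𝓝 (∫ q, D q ∂(ρ : Measure _))) :=
    ((ProbabilityMeasure.continuous_integral_continuousMap D).tendsto ρ).comp hρ
  have hlim : ∫ q, D q ∂(ρ : Measure _) =
      ∫ x, ∫ y, (W x y - c j x y) * (a x * b y) ∂(μ : Measure VertexType)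
        ∂(μ : Measure VertexType) := by
    have hDint : Integrable D (ρ : Measure _) :=
      (BoundedContinuousFunction.mkOfCompact D).integrable _
    rw [← Measure.integral_condKernel hDint, hfst, integral_prod]
    · refine integral_congr_ae (ae_of_all _ fun x => integral_congr_ae (ae_of_all _ fun y => ?_))
      have hr : Integrable (fun r : unitInterval => (r : ℝ))
          ((ρ : Measure _).condKernel (x, y)) :=
        Integrable.of_bound measurable_subtype_coe.aestronglyMeasurable 1 (ae_of_all _ fun r => by
          rw [Real.norm_eq_abs, abs_of_nonneg r.2.1]; exact r.2.2)
      change ∫ r : unitInterval, ((r : ℝ) - c j x y) * (a x * b y) ∂_ = _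
      rw [integral_mul_const, integral_sub hr (integrable_const _)]
      simp [W]
    · rw [← hfst]
      exact hDint.integral_condKernel
  have hlt : |∫ q, D q ∂(ρ : Measure _)| < ε := by
    rw [hlim]
    exact (hcut _ le_rfl a b ha.measurable hb.measurable (fun x => (x j).1.2)
      (fun x => (x j).2.2)).trans_lt (by linarith)
  filter_upwards [hD.abs.eventually_lt_const hlt] with n hn u v _ _ hu hv
  refine (hτ n j fun x => (⟨u x, hu x⟩, ⟨v x, hv x⟩)).trans (le_trans (le_of_eq ?_) hn.le)
  congr 1
  have : ∫ q, D q ∂(law n : Measure _) =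
      ∫ p, D (φ n p) ∂((m n : Measure (Q n)).prod (m n)) :=
    integral_map (hφ n).aemeasurable D.continuous.measurable.aestronglyMeasurable
  rw [this, integral_prod _ Integrable.of_finite]
  rfl

lemma IsLimitKernel.tendsto_digraphDensity {𝒰 : Ultrafilter ℕ} {m : ∀ n, ProbabilityMeasure (Q n)}
    {f : ∀ n, Q n → Q n → unitInterval} {τ : ∀ n, Q n → VertexType}
    {μ : ProbabilityMeasure VertexType} {W : VertexType → VertexType → ℝ}
    (h : IsLimitKernel 𝒰 m f τ μ W) {V : Type*} [Fintype V] {F : Finset (V × V)}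
    (hF : IsOriented F) :
    Tendsto (fun n => digraphDensity F (m n : Measure (Q n)) fun x y => (f n x y : ℝ)) 𝒰
      (𝓝 (digraphDensity F (μ : Measure VertexType) W)) := by
  obtain ⟨hW, hμ, happ⟩ := h
  classical
  have hf : ∀ n, IsDigraphKernel fun x y => (f n x y : ℝ) := fun n =>
    ⟨Measurable.of_discrete, fun x y => (f n x y).2⟩
  rw [Metric.tendsto_nhds]
  intro ε hε
  obtain ⟨c, hc, hcont, hWc, hfc⟩ := happ (ε / (3 * (F.card + 1))) (by positivity)
  have hN : F.card * (ε / (3 * (F.card + 1))) < ε / 3 := by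
    rw [mul_div_assoc', div_lt_div_iff₀ (by positivity) (by positivity)]
    nlinarith
  -- densities of a continuous kernel depend continuously on the measure
  have hct : Tendsto (fun n => digraphDensity F (m n : Measure (Q n))
      fun x y => c (τ n x) (τ n y)) 𝒰 (𝓝 (digraphDensity F (μ : Measure VertexType) c)) := by
    have hG : Continuous fun x : V → VertexType => ∏ p ∈ F, c (x p.1) (x p.2) :=
      continuous_finsetProd _ fun p _ =>
        hcont.comp₂ (continuous_apply p.1) (continuous_apply p.2)
    let G : C(V → VertexType, ℝ) := ⟨_, hG⟩
    have h1 : Tendsto (fun n => ProbabilityMeasure.pi fun _ : V =>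
        (m n).map (Measurable.of_discrete (f := τ n)).aemeasurable) 𝒰
        (𝓝 (ProbabilityMeasure.pi fun _ : V => μ)) :=
      (ProbabilityMeasure.continuous_pi.tendsto _).comp (tendsto_pi_nhds.2 fun _ => hμ)
    refine (((ProbabilityMeasure.continuous_integral_continuousMap G).tendsto _).comp
      h1).congr fun n => ?_
    have hmp : MeasurePreserving (τ n) (m n : Measure (Q n)) ((m n : Measure (Q n)).map (τ n)) :=
      ⟨Measurable.of_discrete, rfl⟩
    have := Measure.isProbabilityMeasure_map (μ := (m n : Measure (Q n)))
      (Measurable.of_discrete (f := τ n)).aemeasurable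
    rw [digraphDensity_map hmp hc]
    rfl
  filter_upwards [hfc, Metric.tendsto_nhds.1 hct (ε / 3) (by positivity)] with n h1 h2
  have h3 := abs_digraphDensity_sub_le (hf n) (hc.comp Measurable.of_discrete) h1 hF
  have h4 := abs_digraphDensity_sub_le hW hc hWc hF
  rw [Real.dist_eq] at h2 ⊢
  rw [abs_lt] at h2 ⊢
  rw [abs_le] at h3 h4
  constructor <;> linarith [h2.1, h2.2, h3.1, h3.2, h4.1, h4.2]

end

/-! ### Monotone real coordinates that determine the kernel -/

section

variable {S : Type*} [MeasurableSpace S] {μ : Measure S} [IsProbabilityMeasure μ]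

/-- Total weight from the point `x` to the set `E`. -/
noncomputable def outWeight (μ : Measure S) (W : S → S → ℝ) (E : Set S) (x : S) : ℝ :=
  ∫ y in E, W x y ∂μ

/-- Total weight from the set `E` to the point `y`. -/
noncomputable def inWeight (μ : Measure S) (W : S → S → ℝ) (E : Set S) (y : S) : ℝ :=
  ∫ x in E, W x y ∂μ

lemma IsDigraphKernel.swap {W : S → S → ℝ} (hW : IsDigraphKernel W) :
    IsDigraphKernel fun x y => W y x :=
  ⟨hW.measurable.comp measurable_swap, fun _ _ => hW.mem_Icc _ _⟩

lemma IsDigraphKernel.norm_le {W : S → S → ℝ} (hW : IsDigraphKernel W) (x y : S) :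
    ‖W x y‖ ≤ 1 := by
  rw [Real.norm_eq_abs, abs_of_nonneg (hW.mem_Icc x y).1]; exact (hW.mem_Icc x y).2

lemma IsDigraphKernel.integrable {W : S → S → ℝ} (hW : IsDigraphKernel W)
    (π : Measure (S × S)) [IsFiniteMeasure π] : Integrable (fun p : S × S => W p.1 p.2) π :=
  Integrable.of_bound hW.measurable.aestronglyMeasurable 1 (ae_of_all _ fun _ => hW.norm_le _ _)

lemma IsDigraphKernel.integrable_right {W : S → S → ℝ} (hW : IsDigraphKernel W)
    (ν : Measure S) [IsFiniteMeasure ν] (x : S) : Integrable (fun y => W x y) ν :=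
  Integrable.of_bound
    (hW.measurable_comp measurable_const measurable_id).aestronglyMeasurable 1
    (ae_of_all _ fun _ => hW.norm_le _ _)

lemma measurable_outWeight {W : S → S → ℝ} (hW : IsDigraphKernel W) (E : Set S) :
    Measurable (outWeight μ W E) :=
  (hW.measurable.stronglyMeasurable.integral_prod_right (ν := μ.restrict E)).measurable

lemma setIntegral_outWeight {W : S → S → ℝ} (hW : IsDigraphKernel W) (A B : Set S) :
    ∫ x in A, outWeight μ W B x ∂μ = ∫ p in A ×ˢ B, W p.1 p.2 ∂(μ.prod μ) := by
  rw [← Measure.prod_restrict, integral_prod _ (hW.integrable _)]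
  rfl

lemma setIntegral_inWeight {W : S → S → ℝ} (hW : IsDigraphKernel W) (A B : Set S) :
    ∫ y in B, inWeight μ W A y ∂μ = ∫ p in A ×ˢ B, W p.1 p.2 ∂(μ.prod μ) := by
  rw [← Measure.prod_restrict, integral_prod_symm _ (hW.integrable _)]
  rfl

lemma integrable_outWeight {W : S → S → ℝ} (hW : IsDigraphKernel W) (E : Set S) (ν : Measure S)
    [IsFiniteMeasure ν] : Integrable (outWeight μ W E) ν := by
  refine Integrable.of_bound (measurable_outWeight hW E).aestronglyMeasurable
    (1 * (μ.restrict E).real Set.univ) (ae_of_all _ fun x => ?_)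
  exact norm_integral_le_of_norm_le_const (ae_of_all _ fun y => hW.norm_le _ _)

/-- Two kernels with equal integrals over rectangles are almost everywhere equal. -/
lemma IsDigraphKernel.ae_eq_of_setIntegral_prod {W W' : S → S → ℝ} (hW : IsDigraphKernel W)
    (hW' : IsDigraphKernel W') (h : ∀ A B : Set S, MeasurableSet A → MeasurableSet B →
      ∫ p in A ×ˢ B, W p.1 p.2 ∂(μ.prod μ) = ∫ p in A ×ˢ B, W' p.1 p.2 ∂(μ.prod μ)) :
    ∀ᵐ p ∂(μ.prod μ), W p.1 p.2 = W' p.1 p.2 := by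
  have hlin : ∀ {K : S → S → ℝ}, IsDigraphKernel K → ∀ s, MeasurableSet s →
      ((μ.prod μ).withDensity fun p => ENNReal.ofReal (K p.1 p.2)) s =
        ENNReal.ofReal (∫ p in s, K p.1 p.2 ∂(μ.prod μ)) := fun hK s hs => by
    rw [withDensity_apply _ hs, ofReal_integral_eq_lintegral_ofReal (hK.integrable _)
      (ae_of_all _ fun p => (hK.mem_Icc _ _).1)]
  have hfin : IsFiniteMeasure ((μ.prod μ).withDensity fun p => ENNReal.ofReal (W p.1 p.2)) :=
    ⟨by rw [hlin hW _ MeasurableSet.univ]; exact ENNReal.ofReal_lt_top⟩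
  have heq : ((μ.prod μ).withDensity fun p => ENNReal.ofReal (W p.1 p.2)) =
      (μ.prod μ).withDensity fun p => ENNReal.ofReal (W' p.1 p.2) := by
    refine Measure.ext_prod fun {A} {B} hA hB => ?_
    rw [hlin hW _ (hA.prod hB), hlin hW' _ (hA.prod hB), h A B hA hB]
  have hm : ∀ {K : S → S → ℝ}, IsDigraphKernel K →
      AEMeasurable (fun p : S × S => ENNReal.ofReal (K p.1 p.2)) (μ.prod μ) := fun hK =>
    hK.measurable.ennreal_ofReal.aemeasurable
  rw [withDensity_eq_iff_of_sigmaFinite (hm hW) (hm hW')] at heq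
  filter_upwards [heq] with p hp
  exact (ENNReal.ofReal_eq_ofReal_iff (hW.mem_Icc _ _).1 (hW'.mem_Icc _ _).1).1 hp

/-- The σ-algebra generated by a function. -/
abbrev sigmaOf {X T : Type*} [MeasurableSpace T] (h : X → T) : MeasurableSpace X :=
  MeasurableSpace.comap h inferInstance

/-- If the weights between points and sets depend only on `h`, measurably, then the kernel itself is
almost everywhere a function of the values of `h`. -/
lemma exists_factor_of_measurable_weight {W : S → S → ℝ} (hW : IsDigraphKernel W)
    {h : S → unitInterval} (hh : Measurable h)
    (hout : ∀ E, MeasurableSet E → Measurable[sigmaOf h] (outWeight μ W E))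
    (hin : ∀ E, MeasurableSet E → Measurable[sigmaOf h] (inWeight μ W E)) :
    ∃ W' : unitInterval → unitInterval → ℝ, IsDigraphKernel W' ∧
      ∀ᵐ p ∂(μ.prod μ), W p.1 p.2 = W' (h p.1) (h p.2) := by
  have h𝒢le : sigmaOf h ≤ ‹MeasurableSpace S› := hh.comap_le
  have h𝒢₂le : sigmaOf (Prod.map h h) ≤ Prod.instMeasurableSpace := (hh.prodMap hh).comap_le
  obtain ⟨g, hg, hgeq⟩ := (stronglyMeasurable_condExp (m := sigmaOf (Prod.map h h)) (μ := μ.prod μ)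
    (f := fun p : S × S => W p.1 p.2)).exists_eq_measurable_comp
  let W' : unitInterval → unitInterval → ℝ := fun s t => max 0 (min 1 (g (s, t)))
  have hW' : IsDigraphKernel W' :=
    ⟨measurable_const.max (measurable_const.min hg.measurable), fun s t =>
      ⟨le_max_left _ _, max_le zero_le_one (min_le_left _ _)⟩⟩
  refine ⟨W', hW', ?_⟩
  have hK : IsDigraphKernel fun x y => W' (h x) (h y) := hW'.comp hh
  have hcond : ∀ᵐ p ∂(μ.prod μ),
      W' (h p.1) (h p.2) = ((μ.prod μ)[fun p : S × S => W p.1 p.2|sigmaOf (Prod.map h h)]) p := by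
    have h0 : 0 ≤ᵐ[μ.prod μ] (μ.prod μ)[fun p : S × S => W p.1 p.2|sigmaOf (Prod.map h h)] :=
      condExp_nonneg (ae_of_all _ fun p => (hW.mem_Icc _ _).1)
    have h1 : (μ.prod μ)[fun p : S × S => W p.1 p.2|sigmaOf (Prod.map h h)] ≤ᵐ[μ.prod μ]
        (μ.prod μ)[fun _ : S × S => (1 : ℝ)|sigmaOf (Prod.map h h)] :=
      condExp_mono (hW.integrable _) (integrable_const _)
        (ae_of_all _ fun p => (hW.mem_Icc _ _).2)
    rw [condExp_const h𝒢₂le] at h1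
    filter_upwards [h0, h1] with p hp0 hp1
    rw [hgeq] at hp0 hp1 ⊢
    change max 0 (min 1 (g (h p.1, h p.2))) = g (h p.1, h p.2)
    exact (congrArg (max 0) (min_eq_right hp1)).trans (max_eq_right hp0)
  -- sections of `W'` are measurable with respect to `sigmaOf h`
  have hout' : ∀ E, Measurable[sigmaOf h] (outWeight μ (fun x y => W' (h x) (h y)) E) := fun E => by
    have h1 : Measurable fun s => ∫ y in E, W' s (h y) ∂μ :=
      ((hW'.measurable.comp (measurable_fst.prodMk
        (hh.comp measurable_snd))).stronglyMeasurable.integral_prod_right'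
          (ν := μ.restrict E)).measurable
    exact h1.comp (comap_measurable h)
  have hin' : ∀ E, Measurable[sigmaOf h] (inWeight μ (fun x y => W' (h x) (h y)) E) := fun E => by
    have h1 : Measurable fun t => ∫ x in E, W' (h x) t ∂μ :=
      ((hW'.measurable.comp ((hh.comp measurable_snd).prodMk
        measurable_fst)).stronglyMeasurable.integral_prod_right'
          (ν := μ.restrict E)).measurable
    exact h1.comp (comap_measurable h)
  -- rectangles with both sides in `sigmaOf h`
  have step1 : ∀ A B, MeasurableSet[sigmaOf h] A → MeasurableSet[sigmaOf h] B →
      ∫ p in A ×ˢ B, W p.1 p.2 ∂(μ.prod μ) =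
        ∫ p in A ×ˢ B, W' (h p.1) (h p.2) ∂(μ.prod μ) := by
    rintro A B ⟨A', hA', rfl⟩ ⟨B', hB', rfl⟩
    have hs : MeasurableSet[sigmaOf (Prod.map h h)] ((h ⁻¹' A') ×ˢ (h ⁻¹' B')) :=
      ⟨A' ×ˢ B', hA'.prod hB', rfl⟩
    rw [← setIntegral_condExp h𝒢₂le (hW.integrable _) hs]
    exact setIntegral_congr_ae (h𝒢₂le _ hs) (hcond.mono fun p hp _ => hp.symm)
  -- rectangles with the first side in `sigmaOf h`
  have step2 : ∀ A B, MeasurableSet[sigmaOf h] A → MeasurableSet B →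
      ∫ p in A ×ˢ B, W p.1 p.2 ∂(μ.prod μ) =
        ∫ p in A ×ˢ B, W' (h p.1) (h p.2) ∂(μ.prod μ) := by
    intro A B hA hB
    have : inWeight μ W A =ᵐ[μ] inWeight μ (fun x y => W' (h x) (h y)) A := by
      refine ae_eq_of_forall_setIntegral_eq_of_sigmaFinite' h𝒢le
        (fun s _ _ => (integrable_outWeight hW.swap A _).integrableOn)
        (fun s _ _ => (integrable_outWeight hK.swap A _).integrableOn) (fun s hs _ => ?_)
        (hin A (h𝒢le _ hA)).stronglyMeasurable.aestronglyMeasurable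
        (hin' A).stronglyMeasurable.aestronglyMeasurable
      rw [setIntegral_inWeight hW, setIntegral_inWeight hK]
      exact step1 A s hA hs
    rw [← setIntegral_inWeight hW, ← setIntegral_inWeight hK]
    exact setIntegral_congr_ae hB (this.mono fun x hx _ => hx)
  refine hW.ae_eq_of_setIntegral_prod hK fun A B hA hB => ?_
  have : outWeight μ W B =ᵐ[μ] outWeight μ (fun x y => W' (h x) (h y)) B := by
    refine ae_eq_of_forall_setIntegral_eq_of_sigmaFinite' h𝒢le
      (fun s _ _ => (integrable_outWeight hW B _).integrableOn)
      (fun s _ _ => (integrable_outWeight hK B _).integrableOn) (fun s hs _ => ?_)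
      (hout B hB).stronglyMeasurable.aestronglyMeasurable
      (hout' B).stronglyMeasurable.aestronglyMeasurable
    rw [setIntegral_outWeight hW, setIntegral_outWeight hK]
    exact step2 s B hs hB
  rw [← setIntegral_outWeight hW, ← setIntegral_outWeight hK]
  exact setIntegral_congr_ae hA (this.mono fun x hx _ => hx)

/-- Along an edge, the weights to sets decrease and the weights from sets increase. -/
lemma ae_weight_monotone {W : S → S → ℝ} (hW : IsDigraphKernel W)
    (h : IsTransitiveInDensity μ W) :
    ∀ᵐ p ∂(μ.prod μ), 0 < W p.1 p.2 →
      ∀ E, outWeight μ W E p.2 ≤ outWeight μ W E p.1 ∧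
        inWeight μ W E p.1 ≤ inWeight μ W E p.2 := by
  have h1 : ∀ᵐ p ∂(μ.prod μ), ∀ᵐ z ∂μ, 0 < W p.1 p.2 → 0 < W p.2 z → W p.1 z = 1 :=
    Measure.ae_ae_of_ae_prod
      ((measurePreserving_prodAssoc μ μ μ).quasiMeasurePreserving.ae (h.ae_eq_one hW))
  have h2 : ∀ᵐ p ∂(μ.prod μ), ∀ᵐ x ∂μ, 0 < W x p.1 → 0 < W p.1 p.2 → W x p.2 = 1 :=
    Measure.ae_ae_of_ae_prod
      (Measure.measurePreserving_swap.quasiMeasurePreserving.ae (h.ae_eq_one hW))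
  filter_upwards [h1, h2] with p hp1 hp2 hpos E
  constructor
  · refine integral_mono_ae (hW.integrable_right _ _) (hW.integrable_right _ _)
      (ae_restrict_of_ae (hp1.mono fun z hz => ?_))
    rcases (hW.mem_Icc p.2 z).1.eq_or_lt with h0 | h0
    · change W p.2 z ≤ W p.1 z
      rw [← h0]; exact (hW.mem_Icc _ _).1
    · change W p.2 z ≤ W p.1 z
      rw [hz hpos h0]; exact (hW.mem_Icc _ _).2
  · refine integral_mono_ae (hW.swap.integrable_right _ _) (hW.swap.integrable_right _ _)
      (ae_restrict_of_ae (hp2.mono fun x hx => ?_))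
    rcases (hW.mem_Icc x p.1).1.eq_or_lt with h0 | h0
    · change W x p.1 ≤ W x p.2
      rw [← h0]; exact (hW.mem_Icc _ _).1
    · change W x p.1 ≤ W x p.2
      rw [hx h0 hpos]; exact (hW.mem_Icc _ _).2

/-- A countable family of bits can be stored in a number in `[0,1]`, monotonically in each bit. -/
lemma exists_monotone_measurableEmbedding_bits :
    ∃ e : (ℕ → Bool) → unitInterval, Monotone e ∧ MeasurableEmbedding e := by
  have hmeas : Measurable (Cardinal.cantorFunction (1 / 3)) := by
    refine (continuous_tsum (u := fun n => (1 / 3 : ℝ) ^ n) (fun n => ?_)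
      (summable_geometric_of_lt_one (by norm_num) (by norm_num)) fun n f => ?_).measurable
    · exact (continuous_of_discreteTopology (f := fun b : Bool => cond b ((1 / 3 : ℝ) ^ n) 0)).comp
        (continuous_apply n)
    · rw [Real.norm_eq_abs, abs_of_nonneg (Cardinal.cantorFunctionAux_nonneg (by norm_num))]
      cases hb : f n
      · rw [Cardinal.cantorFunctionAux_false hb]; positivity
      · rw [Cardinal.cantorFunctionAux_true hb]
  refine ⟨fun f => unitInterval.sigmoid (Cardinal.cantorFunction (1 / 3) f), fun f g hfg => ?_,
    measurableEmbedding_sigmoid.comp (hmeas.measurableEmbedding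
      (Cardinal.cantorFunction_injective (by norm_num) (by norm_num)))⟩
  refine unitInterval.sigmoid_monotone (Cardinal.cantorFunction_le (by norm_num) (by norm_num)
    fun n hn => ?_)
  have := hfg n
  rw [hn] at this
  exact le_antisymm le_top this

lemma measurable_of_measurableSet_le_rat {X : Type*} {m : MeasurableSpace X} {f : X → ℝ}
    (h : ∀ r : ℚ, MeasurableSet {x | f x ≤ r}) : Measurable f := by
  rw [BorelSpace.measurable_eq (α := ℝ), Real.borel_eq_generateFrom_Iic_rat]
  refine measurable_generateFrom fun t ht => ?_
  obtain ⟨r, rfl⟩ := Set.mem_iUnion.1 ht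
  exact h r

/-- It suffices to check the measurability of weights to sets on a generating π-system. -/
lemma measurable_outWeight_of_isPiSystem {T : Type*} [MeasurableSpace T] {d : S → T}
    {W : S → S → ℝ} (hW : IsDigraphKernel W) {𝒞 : Set (Set S)}
    (hgen : ‹MeasurableSpace S› = MeasurableSpace.generateFrom 𝒞) (hpi : IsPiSystem 𝒞)
    (huniv : Set.univ ∈ 𝒞) (h : ∀ E ∈ 𝒞, Measurable[sigmaOf d] (outWeight μ W E)) :
    ∀ E, MeasurableSet E → Measurable[sigmaOf d] (outWeight μ W E) := by
  intro E hE
  induction E, hE using MeasurableSpace.induction_on_inter hgen hpi with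
  | empty =>
    have : outWeight μ W ∅ = fun _ => 0 := by ext x; simp [outWeight]
    rw [this]
    exact measurable_const
  | basic E hE => exact h E hE
  | compl E hE ih =>
    have : outWeight μ W Eᶜ = fun x => outWeight μ W Set.univ x - outWeight μ W E x := by
      ext x
      have := integral_add_compl hE (hW.integrable_right μ x)
      rw [outWeight, outWeight, outWeight, setIntegral_univ]
      linarith
    rw [this]
    exact (h _ huniv).sub ih
  | iUnion f hdisj hf ih =>
    have : outWeight μ W (⋃ i, f i) = fun x => ∑' i, outWeight μ W (f i) x := by
      ext x
      exact integral_iUnion hf hdisj (hW.integrable_right _ _).integrableOn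
    rw [this]
    exact @Measurable.tsum S ℝ ℕ (sigmaOf d) _ _ _ _ _ _ _ _ _ _ _ _ ih

/-- The monotone coordinate of a transitive kernel: `h` encodes all the comparisons of the weights
to and from the sets of a countable generating algebra with rational numbers. It increases along
edges and determines the kernel. -/
lemma exists_monotone_factor [MeasurableSpace.CountablyGenerated S] {W : S → S → ℝ}
    (hW : IsDigraphKernel W) (hT : IsTransitiveInDensity μ W) :
    ∃ (h : S → unitInterval) (W' : unitInterval → unitInterval → ℝ), Measurable h ∧
      IsDigraphKernel W' ∧ (∀ᵐ p ∂(μ.prod μ), W p.1 p.2 = W' (h p.1) (h p.2)) ∧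
      ∀ᵐ p ∂(μ.prod μ), 0 < W p.1 p.2 → h p.1 ≤ h p.2 := by
  classical
  let 𝒞 := generateSetAlgebra (MeasurableSpace.countableGeneratingSet S)
  have hgen : ‹MeasurableSpace S› = MeasurableSpace.generateFrom 𝒞 := by
    rw [generateFrom_generateSetAlgebra_eq, MeasurableSpace.generateFrom_countableGeneratingSet]
  have halg : IsSetAlgebra 𝒞 := isSetAlgebra_generateSetAlgebra
  have hpi : IsPiSystem 𝒞 := fun s hs t ht _ => halg.inter_mem hs ht
  obtain ⟨E, hE⟩ := (countable_generateSetAlgebra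
    (MeasurableSpace.countable_countableGeneratingSet (α := S))).exists_eq_range
      ⟨Set.univ, halg.univ_mem⟩
  replace hE : 𝒞 = Set.range E := hE
  -- for each set `E i` and each rational `r`, a bit comparing the weight to `E i` with `r`, and a
  -- bit comparing the weight from `E i` with `r`
  let bit : ℕ × ℚ × Bool → Set S := fun k =>
    cond k.2.2 {x | outWeight μ W (E k.1) x ≤ k.2.1} {x | (k.2.1 : ℝ) ≤ inWeight μ W (E k.1) x}
  have hbit : ∀ k, MeasurableSet (bit k) := by
    rintro ⟨i, r, b⟩
    cases b
    · exact measurableSet_le measurable_const (measurable_outWeight hW.swap _)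
    · exact measurableSet_le (measurable_outWeight hW _) measurable_const
  obtain ⟨idx, hidx⟩ := exists_surjective_nat (ℕ × ℚ × Bool)
  let d : S → ℕ → Bool := fun x k => decide (x ∈ bit (idx k))
  have hd : Measurable d := measurable_pi_lambda _ fun k =>
    measurable_to_bool (by
      convert hbit (idx k) using 1
      ext x; simp [d])
  obtain ⟨e, hemono, hemb⟩ := exists_monotone_measurableEmbedding_bits
  have hcomap : sigmaOf (fun x => e (d x)) = sigmaOf d := by
    rw [sigmaOf, sigmaOf, ← hemb.comap_eq, MeasurableSpace.comap_comp]
    rfl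
  have hbitd : ∀ k, MeasurableSet[sigmaOf d] (bit k) := fun k => by
    obtain ⟨n, rfl⟩ := hidx k
    refine ⟨(fun f => f n) ⁻¹' {true},
      measurable_pi_apply (X := fun _ : ℕ => Bool) n (measurableSet_singleton true), ?_⟩
    ext x; simp [d]
  have hh : Measurable fun x => e (d x) := hemb.measurable.comp hd
  have hout : ∀ A, MeasurableSet A → Measurable[sigmaOf d] (outWeight μ W A) := by
    refine measurable_outWeight_of_isPiSystem hW hgen hpi halg.univ_mem fun A hA => ?_
    obtain ⟨i, rfl⟩ := hE ▸ hA
    exact measurable_of_measurableSet_le_rat fun r => hbitd (i, r, true)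
  have hin : ∀ A, MeasurableSet A → Measurable[sigmaOf d] (inWeight μ W A) := by
    refine measurable_outWeight_of_isPiSystem hW.swap hgen hpi halg.univ_mem fun A hA => ?_
    obtain ⟨i, rfl⟩ := hE ▸ hA
    have : Measurable[sigmaOf d] fun x => - inWeight μ W (E i) x :=
      measurable_of_measurableSet_le_rat fun r => by
        convert hbitd (i, -r, false) using 1
        ext x
        simp [bit, neg_le]
    convert this.neg using 1
    ext x
    exact (neg_neg _).symm
  obtain ⟨W', hW', hfac⟩ := exists_factor_of_measurable_weight hW hh
    (by rwa [hcomap]) (by rwa [hcomap])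
  refine ⟨fun x => e (d x), W', hh, hW', hfac, ?_⟩
  filter_upwards [ae_weight_monotone hW hT] with p hp hpos
  refine hemono fun k => ?_
  have hk : p.1 ∈ bit (idx k) → p.2 ∈ bit (idx k) := by
    generalize idx k = κ
    obtain ⟨i, r, b⟩ := κ
    cases b
    · exact fun hx => le_trans hx (hp hpos (E i)).2
    · exact fun hx => le_trans (hp hpos (E i)).1 hx
  by_cases hx : p.1 ∈ bit (idx k)
  · simp [d, hx, hk hx]
  · simp [d, hx]

end

/-! ### Transfer to the unit interval with its order -/

/-- Every law on `[0,1]` is the image of Lebesgue measure under a monotone map, its quantile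
function. -/
lemma exists_monotone_map_eq (ν : Measure unitInterval) [IsProbabilityMeasure ν] :
    ∃ q : unitInterval → unitInterval, Monotone q ∧ MeasurePreserving q volume ν := by
  let q : unitInterval → unitInterval := fun t => sSup {x | ν.real (Set.Iic x) < t}
  have hq : Monotone q := fun s t hst =>
    sSup_le_sSup fun x hx => lt_of_lt_of_le (b := (s : ℝ)) hx hst
  refine ⟨q, hq, hq.measurable, ?_⟩
  have := Measure.isProbabilityMeasure_map (μ := (volume : Measure unitInterval))
    hq.measurable.aemeasurable
  refine Measure.ext_of_Iic _ _ fun x => ?_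
  have hmem : ν.real (Set.Iic x) ∈ unitInterval := ⟨measureReal_nonneg, measureReal_le_one⟩
  have hpre : q ⁻¹' Set.Iic x = Set.Iic ⟨ν.real (Set.Iic x), hmem⟩ := by
    ext t
    simp only [Set.mem_preimage, Set.mem_Iic]
    constructor
    · intro ht
      change (t : ℝ) ≤ ν.real (Set.Iic x)
      -- `ν (Iic x)` is the limit of `ν (Iic y)` for `y` decreasing to `x`
      rcases eq_or_ne x 1 with rfl | hx
      · have : Set.Iic (1 : unitInterval) = Set.univ := Set.eq_univ_of_forall fun y => y.2.2
        rw [this]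
        simpa using t.2.2
      · obtain ⟨u, hanti, hu, hlim⟩ := exists_seq_strictAnti_tendsto'
          (show x < 1 from lt_of_le_of_ne x.2.2 hx)
        have hint : ⋂ n, Set.Iic (u n) = Set.Iic x := by
          ext y
          simp only [Set.mem_iInter, Set.mem_Iic]
          exact ⟨fun h => ge_of_tendsto' hlim h, fun h n => h.trans (hu n).1.le⟩
        have hmeas := tendsto_measure_iInter_atTop (μ := ν) (s := fun n => Set.Iic (u n))
          (fun n => measurableSet_Iic.nullMeasurableSet)
          (fun m n hmn => Set.Iic_subset_Iic.2 (hanti.antitone hmn)) ⟨0, measure_ne_top _ _⟩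
        rw [hint] at hmeas
        rw [measureReal_def, ← ENNReal.ofReal_le_iff_le_toReal (measure_ne_top _ _)]
        refine ge_of_tendsto' hmeas fun n => ?_
        change ENNReal.ofReal t ≤ ν (Set.Iic (u n))
        rw [ENNReal.ofReal_le_iff_le_toReal (measure_ne_top _ _)]
        by_contra! hn
        exact absurd ((le_sSup (show u n ∈ {x | ν.real (Set.Iic x) < t} from hn)).trans ht)
          (not_le.2 (hu n).1)
    · intro ht
      refine sSup_le fun y hy => le_of_lt ?_
      by_contra! hxy
      have h1 : ν.real (Set.Iic x) ≤ ν.real (Set.Iic y) :=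
        measureReal_mono (Set.Iic_subset_Iic.2 hxy)
      have h2 : ν.real (Set.Iic y) < t := hy
      exact absurd (show (t : ℝ) ≤ ν.real (Set.Iic x) from ht) (not_le.2 (h1.trans_lt h2))
  rw [Measure.map_apply hq.measurable measurableSet_Iic, hpre, unitInterval.volume_Iic]
  exact ofReal_measureReal

lemma digraphDensity_eq_of_common_factor {S S' T : Type*} [MeasurableSpace S] [MeasurableSpace S']
    [MeasurableSpace T] {μ : Measure S} {μ' : Measure S'} {ν : Measure T} [IsProbabilityMeasure μ]
    [IsProbabilityMeasure μ'] [IsProbabilityMeasure ν] {h : S → T} {q : S' → T}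
    (hh : MeasurePreserving h μ ν) (hq : MeasurePreserving q μ' ν) {W : S → S → ℝ}
    {W' : T → T → ℝ} (hW : IsDigraphKernel W) (hW' : IsDigraphKernel W')
    (hfac : ∀ᵐ p ∂(μ.prod μ), W p.1 p.2 = W' (h p.1) (h p.2))
    {V : Type*} [Fintype V] {F : Finset (V × V)} (hF : IsOriented F) :
    digraphDensity F μ' (fun s t => W' (q s) (q t)) = digraphDensity F μ W := by
  classical
  rw [digraphDensity_map hq hW', ← digraphDensity_map hh hW']
  exact digraphDensity_congr_ae (hW'.comp hh.measurable) hW (hfac.mono fun p hp => hp.symm) hF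

/-- A transitive kernel on a countably generated probability space can be realised on `[0,1]` with
edges following the standard order. -/
lemma exists_ordered_kernel {S : Type*} [MeasurableSpace S] [MeasurableSpace.CountablyGenerated S]
    {μ : Measure S} [IsProbabilityMeasure μ] {W : S → S → ℝ} (hW : IsDigraphKernel W)
    (hT : IsTransitiveInDensity μ W) :
    ∃ U : unitInterval → unitInterval → ℝ, IsDigraphKernel U ∧
      (∀ {V : Type v} [Fintype V] (F : Finset (V × V)), IsOriented F →
        digraphDensity F volume U = digraphDensity F μ W) ∧
      IsTransitiveInDensity volume U ∧
      ∀ᵐ p : unitInterval × unitInterval, 0 < U p.1 p.2 → p.1 < p.2 := by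
  obtain ⟨h, W', hh, hW', hfac, hmono⟩ := exists_monotone_factor hW hT
  have := Measure.isProbabilityMeasure_map (μ := μ) hh.aemeasurable
  obtain ⟨q, hq, hqν⟩ := exists_monotone_map_eq (μ.map h)
  have hhν : MeasurePreserving h μ (μ.map h) := ⟨hh, rfl⟩
  let U : unitInterval → unitInterval → ℝ := fun s t => W' (q s) (q t)
  have hU : IsDigraphKernel U := hW'.comp hq.measurable
  have hTU : IsTransitiveInDensity volume U :=
    ⟨by
      rw [digraphDensity_eq_of_common_factor hhν hqν hW hW' hfac isOriented_pathEdges,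
        digraphDensity_eq_of_common_factor hhν hqν hW hW' hfac isOriented_chainEdges,
        hT.path_eq_chain],
    by
      rw [digraphDensity_eq_of_common_factor hhν hqν hW hW' hfac isOriented_cycleEdges,
        hT.cycle_eq_zero]⟩
  refine ⟨U, hU, fun F hF => digraphDensity_eq_of_common_factor hhν hqν hW hW' hfac hF, hTU, ?_⟩
  have hle : ∀ᵐ p : unitInterval × unitInterval, 0 < U p.1 p.2 → q p.1 ≤ q p.2 := by
    have hms : MeasurableSet {r : unitInterval × unitInterval | 0 < W' r.1 r.2 → r.1 ≤ r.2} :=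
      (measurableSet_lt measurable_const hW'.measurable).imp
        (measurableSet_le measurable_fst measurable_snd)
    have h1 : ∀ᵐ r ∂((μ.map h).prod (μ.map h)), 0 < W' r.1 r.2 → r.1 ≤ r.2 := by
      rw [← (hhν.prod hhν).map_eq, ae_map_iff (hhν.prod hhν).measurable.aemeasurable hms]
      filter_upwards [hfac, hmono] with p hp hp' hpos
      exact hp' (hp ▸ hpos)
    exact (hqν.prod hqν).quasiMeasurePreserving.ae h1
  -- an edge from `s` to `t < s` forces `q` to be constant on `[t, s]`, so that all pairs in this
  -- interval are edges and cycles have positive measure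
  have hcyc : volume {c : unitInterval × unitInterval × unitInterval |
      0 < U c.1 c.2.1 ∧ 0 < U c.2.1 c.2.2 ∧ 0 < U c.2.2 c.1} = 0 := by
    have := hTU.ae_not_cycle hU
    rw [ae_iff] at this
    simp only [not_not] at this
    exact this
  have hdiag : ∀ᵐ p : unitInterval × unitInterval, p.1 ≠ p.2 := by
    have hd : MeasurableSet {p : unitInterval × unitInterval | p.1 = p.2} :=
      measurableSet_eq_fun measurable_fst measurable_snd
    have h0 : volume {p : unitInterval × unitInterval | p.1 = p.2} = 0 := by
      rw [Measure.volume_eq_prod, Measure.measure_prod_null hd]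
      refine ae_of_all _ fun s => ?_
      have : Prod.mk s ⁻¹' {p : unitInterval × unitInterval | p.1 = p.2} = {s} := by
        ext t; exact eq_comm
      change volume (Prod.mk s ⁻¹' _) = 0
      rw [this, measure_singleton]
    exact measure_eq_zero_iff_ae_notMem.1 h0
  filter_upwards [hle, hdiag] with p hp hne hpos
  by_contra hnot
  have hlt : p.2 < p.1 := lt_of_le_of_ne (not_lt.1 hnot) (Ne.symm hne)
  have hqeq : q p.1 = q p.2 := le_antisymm (hp hpos) (hq hlt.le)
  have hconst : ∀ r ∈ Set.Icc p.2 p.1, q r = q p.2 := fun r hr =>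
    le_antisymm ((hq hr.2).trans hqeq.le) (hq hr.1)
  have hedge : ∀ r ∈ Set.Icc p.2 p.1, ∀ r' ∈ Set.Icc p.2 p.1, 0 < U r r' := fun r hr r' hr' => by
    change 0 < W' (q r) (q r')
    rw [hconst r hr, hconst r' hr']
    have : 0 < W' (q p.1) (q p.2) := hpos
    rwa [hqeq] at this
  have hsub : Set.Icc p.2 p.1 ×ˢ (Set.Icc p.2 p.1 ×ˢ Set.Icc p.2 p.1) ⊆
      {c : unitInterval × unitInterval × unitInterval |
        0 < U c.1 c.2.1 ∧ 0 < U c.2.1 c.2.2 ∧ 0 < U c.2.2 c.1} := fun c hc =>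
    ⟨hedge _ hc.1 _ hc.2.1, hedge _ hc.2.1 _ hc.2.2, hedge _ hc.2.2 _ hc.1⟩
  have h0 := measure_mono_null hsub hcyc
  rw [Measure.volume_eq_prod, Measure.prod_prod, Measure.volume_eq_prod, Measure.prod_prod,
    unitInterval.volume_Icc] at h0
  have hpos' : ENNReal.ofReal ((p.1 : ℝ) - p.2) ≠ 0 :=
    (ENNReal.ofReal_pos.2 (sub_pos.2 hlt)).ne'
  exact mul_ne_zero hpos' (mul_ne_zero hpos' hpos') h0

/-! ### Density points and the removal of null sets -/

section

open Metric

/-- The point `p` of the unit square is a density point of `A`. -/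
def IsDensityPoint (A : Set (unitInterval × unitInterval)) (p : unitInterval × unitInterval) :
    Prop :=
  Tendsto (fun n : ℕ => volume (Aᶜ ∩ closedBall p (1 / (n + 1 : ℝ))) /
    volume (closedBall p (1 / (n + 1 : ℝ)))) atTop (𝓝 0)

/-- Lebesgue's density theorem on the unit square. -/
lemma ae_isDensityPoint_iff {A : Set (unitInterval × unitInterval)} (hA : MeasurableSet A) :
    ∀ᵐ p, IsDensityPoint A p ↔ p ∈ A := by
  let ι : unitInterval × unitInterval → ℝ × ℝ := Prod.map Subtype.val Subtype.val
  have hι : MeasurableEmbedding ι :=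
    unitInterval.measurableEmbedding_coe.prodMap unitInterval.measurableEmbedding_coe
  have hball : ∀ p r, ι ⁻¹' closedBall (ι p) r = closedBall p r := fun p r => by
    ext p'
    simp [ι, Prod.dist_eq, Subtype.dist_eq]
  have : IsProbabilityMeasure ((volume : Measure (unitInterval × unitInterval)).map ι) :=
    Measure.isProbabilityMeasure_map hι.measurable.aemeasurable
  have h := ae_of_ae_map hι.measurable.aemeasurable
    (Besicovitch.ae_tendsto_measure_inter_div_of_measurableSet
      ((volume : Measure (unitInterval × unitInterval)).map ι)
        (hι.measurableSet_image.2 hA.compl))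
  have hr : Tendsto (fun n : ℕ => 1 / (n + 1 : ℝ)) atTop (𝓝[>] 0) :=
    tendsto_nhdsWithin_iff.2 ⟨tendsto_one_div_add_atTop_nhds_zero_nat,
      Eventually.of_forall fun n => Set.mem_Ioi.2 (by positivity)⟩
  filter_upwards [h] with p hp
  have hp' := hp.comp hr
  simp only [Function.comp_def, hι.map_apply, Set.preimage_inter,
    Set.preimage_image_eq _ hι.injective, hball] at hp'
  by_cases hpA : p ∈ A
  · rw [Set.indicator_of_notMem (by rintro ⟨p', hp', he⟩; exact hp' (hι.injective he ▸ hpA))] at hp'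
    exact iff_of_true hp' hpA
  · rw [Set.indicator_of_mem (show ι p ∈ ι '' Aᶜ from ⟨p, hpA, rfl⟩)] at hp'
    exact iff_of_false (fun h0 => zero_ne_one (tendsto_nhds_unique h0 hp')) hpA

lemma measurableSet_isDensityPoint {A : Set (unitInterval × unitInterval)}
    (hA : MeasurableSet A) : MeasurableSet {p | IsDensityPoint A p} := by
  have key : ∀ (B : Set (unitInterval × unitInterval)), MeasurableSet B → ∀ r : ℝ,
      Measurable fun p => volume (B ∩ closedBall p r) := fun B hB r => by
    have hs : MeasurableSet {t : (unitInterval × unitInterval) × (unitInterval × unitInterval) |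
        t.2 ∈ B ∧ dist t.2 t.1 ≤ r} :=
      (measurable_snd hB).inter
        (measurableSet_le (measurable_snd.dist measurable_fst) measurable_const)
    exact measurable_measure_prodMk_left hs
  refine measurableSet_tendsto _ fun n => ?_
  have h1 := key Aᶜ hA.compl (1 / (n + 1 : ℝ))
  have h2 := key Set.univ MeasurableSet.univ (1 / (n + 1 : ℝ))
  simp only [Set.univ_inter] at h2
  exact h1.div h2

lemma IsDensityPoint.mono {A B : Set (unitInterval × unitInterval)}
    {p : unitInterval × unitInterval} (h : IsDensityPoint A p) (hAB : A ⊆ B) :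
    IsDensityPoint B p :=
  tendsto_of_tendsto_of_tendsto_of_le_of_le tendsto_const_nhds h (fun _ => zero_le)
    fun _ => ENNReal.div_le_div_right (measure_mono
      (Set.inter_subset_inter_left _ (Set.compl_subset_compl.2 hAB))) _

lemma volume_closedBall_pos (x : unitInterval) {r : ℝ} (hr : 0 < r) :
    0 < volume (closedBall x r) := by
  let a : unitInterval := ⟨max 0 (x - r), le_max_left _ _, max_le zero_le_one (by linarith [x.2.2])⟩
  let b : unitInterval := ⟨min 1 (x + r), le_min zero_le_one (by linarith [x.2.1]), min_le_left _ _⟩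
  have hab : (a : ℝ) < b := by
    have h0 := x.2.1
    have h1 := x.2.2
    refine max_lt (lt_min one_pos (by linarith)) (lt_min (by linarith) (by linarith))
  have hsub : Set.Icc a b ⊆ closedBall x r := fun t ht => by
    have h1 : (x : ℝ) - r ≤ t := (le_max_right _ _).trans ht.1
    have h2 : (t : ℝ) ≤ x + r := le_trans ht.2 (min_le_right _ _)
    rw [mem_closedBall, Subtype.dist_eq, Real.dist_eq, abs_le]
    constructor <;> linarith
  refine lt_of_lt_of_le ?_ (measure_mono hsub)
  rw [unitInterval.volume_Icc, ENNReal.ofReal_pos]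
  linarith

/-- If almost every path with edges in `A` and `B` is bridged by `C`, then density points of `A` and
`B` forming a path are bridged by a density point of `C`: in a small box around the path, almost all
paths have their edges in `A` and `B`. -/
lemma IsDensityPoint.trans {A B C : Set (unitInterval × unitInterval)} (hA : MeasurableSet A)
    (hC : MeasurableSet C)
    (h : ∀ᵐ t : unitInterval × unitInterval × unitInterval,
      (t.1, t.2.1) ∈ A → (t.2.1, t.2.2) ∈ B → (t.1, t.2.2) ∈ C)
    {x y z : unitInterval} (hxy : IsDensityPoint A (x, y)) (hyz : IsDensityPoint B (y, z)) :
    IsDensityPoint C (x, z) := by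
  have hsum := hxy.add hyz
  rw [add_zero] at hsum
  refine tendsto_of_tendsto_of_tendsto_of_le_of_le tendsto_const_nhds hsum (fun _ => zero_le)
    fun n => ?_
  have hr : (0 : ℝ) < 1 / (n + 1 : ℝ) := by positivity
  set r : ℝ := 1 / (n + 1 : ℝ)
  simp only [← closedBall_prod_same, Measure.volume_eq_prod, Measure.prod_prod]
  set X := closedBall x r
  set Y := closedBall y r
  set Z := closedBall z r
  have hX : MeasurableSet X := isClosed_closedBall.measurableSet
  have hY : MeasurableSet Y := isClosed_closedBall.measurableSet
  have hZ : MeasurableSet Z := isClosed_closedBall.measurableSet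
  let μ : Measure unitInterval := volume
  -- the volumes of three cylinders over sets of pairs
  have hcyl : ∀ (D : Set (unitInterval × unitInterval)) (E : Set unitInterval),
      MeasurableSet D → MeasurableSet E →
      MeasurableSet {t : unitInterval × unitInterval × unitInterval |
        (t.1, t.2.1) ∈ D ∧ t.2.2 ∈ E} := fun D E hD hE =>
    (measurable_fst.prodMk measurable_snd.fst hD).inter (measurable_snd.snd hE)
  have c1 : ∀ (D : Set (unitInterval × unitInterval)) (E : Set unitInterval),
      MeasurableSet D → MeasurableSet E →
      (μ.prod (μ.prod μ)) {t | (t.1, t.2.1) ∈ D ∧ t.2.2 ∈ E} = (μ.prod μ) D * μ E := by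
    intro D E hD hE
    rw [← Measure.prod_prod, ← (measurePreserving_prodAssoc μ μ μ).measure_preimage
      (hcyl D E hD hE).nullMeasurableSet]
    rfl
  have c2 : (μ.prod (μ.prod μ)) {t | t.1 ∈ X ∧ (t.2.1, t.2.2) ∈ Bᶜ ∩ Y ×ˢ Z} =
      μ X * (μ.prod μ) (Bᶜ ∩ Y ×ˢ Z) := by
    rw [← Measure.prod_prod]
    rfl
  have c3 : (μ.prod (μ.prod μ)) {t | (t.1, t.2.2) ∈ Cᶜ ∩ X ×ˢ Z ∧ t.2.1 ∈ Y} =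
      (μ.prod μ) (Cᶜ ∩ X ×ˢ Z) * μ Y := by
    have hswap : MeasurePreserving (Prod.map id Prod.swap) (μ.prod (μ.prod μ))
        (μ.prod (μ.prod μ)) := (MeasurePreserving.id μ).prod Measure.measurePreserving_swap
    have hD := hC.compl.inter (hX.prod hZ)
    rw [← c1 _ _ hD hY, ← hswap.measure_preimage (hcyl _ _ hD hY).nullMeasurableSet]
    rfl
  have hle : (μ.prod μ) (Cᶜ ∩ X ×ˢ Z) * μ Y ≤
      (μ.prod μ) (Aᶜ ∩ X ×ˢ Y) * μ Z + μ X * (μ.prod μ) (Bᶜ ∩ Y ×ˢ Z) := by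
    rw [← c1 _ _ (hA.compl.inter (hX.prod hY)) hZ, ← c2, ← c3]
    refine (measure_mono_ae ?_).trans (measure_union_le _ _)
    filter_upwards [h] with t ht ht3
    obtain ⟨⟨hnC, hx, hz⟩, hy⟩ := ht3
    by_cases h1 : (t.1, t.2.1) ∈ A
    · exact Or.inr ⟨hx, fun h2 => hnC (ht h1 h2), hy, hz⟩
    · exact Or.inl ⟨⟨h1, hx, hy⟩, hz⟩
  have hX0 := (volume_closedBall_pos x hr).ne'
  have hY0 := (volume_closedBall_pos y hr).ne'
  have hZ0 := (volume_closedBall_pos z hr).ne'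
  have hXt : μ X ≠ ⊤ := measure_ne_top _ _
  have hYt : μ Y ≠ ⊤ := measure_ne_top _ _
  have hZt : μ Z ≠ ⊤ := measure_ne_top _ _
  change (μ.prod μ) (Cᶜ ∩ X ×ˢ Z) / (μ X * μ Z) ≤
    (μ.prod μ) (Aᶜ ∩ X ×ˢ Y) / (μ X * μ Y) + (μ.prod μ) (Bᶜ ∩ Y ×ˢ Z) / (μ Y * μ Z)
  have e1 : (μ.prod μ) (Cᶜ ∩ X ×ˢ Z) / (μ X * μ Z) =
      (μ.prod μ) (Cᶜ ∩ X ×ˢ Z) * μ Y / (μ X * μ Z * μ Y) :=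
    (ENNReal.mul_div_mul_right _ _ hY0 hYt).symm
  have e2 : (μ.prod μ) (Aᶜ ∩ X ×ˢ Y) / (μ X * μ Y) =
      (μ.prod μ) (Aᶜ ∩ X ×ˢ Y) * μ Z / (μ X * μ Z * μ Y) := by
    rw [mul_right_comm, ENNReal.mul_div_mul_right _ _ hZ0 hZt]
  have e3 : (μ.prod μ) (Bᶜ ∩ Y ×ˢ Z) / (μ Y * μ Z) =
      μ X * (μ.prod μ) (Bᶜ ∩ Y ×ˢ Z) / (μ X * μ Z * μ Y) := by
    rw [mul_assoc, mul_comm (μ Z), ENNReal.mul_div_mul_left _ _ hX0 hXt]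
  rw [e1, e2, e3, ← ENNReal.add_div]
  exact ENNReal.div_le_div_right hle _

/-- Changing a kernel on a null set turns almost everywhere transitivity into transitivity: edges
are kept at density points of the set of edges only, and get weight `1` at density points of the set
of edges of weight `1`. -/
lemma exists_isPosetKernel_ae_eq {U : unitInterval → unitInterval → ℝ} (hU : IsDigraphKernel U)
    (hT : IsTransitiveInDensity volume U)
    (hlt : ∀ᵐ p : unitInterval × unitInterval, 0 < U p.1 p.2 → p.1 < p.2) :
    ∃ U' : unitInterval → unitInterval → ℝ,
      IsPosetKernel (volume : Measure unitInterval) (fun x y => x < y) U' ∧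
      IsDigraphKernel U' ∧ ∀ᵐ p : unitInterval × unitInterval, U' p.1 p.2 = U p.1 p.2 := by
  classical
  let A : Set (unitInterval × unitInterval) := {p | 0 < U p.1 p.2}
  let B : Set (unitInterval × unitInterval) := {p | U p.1 p.2 = 1}
  have hA : MeasurableSet A := measurableSet_lt measurable_const hU.measurable
  have hB : MeasurableSet B := hU.measurable (measurableSet_singleton 1)
  have hBA : B ⊆ A := fun p (hp : U p.1 p.2 = 1) => show 0 < U p.1 p.2 from hp ▸ one_pos
  let U' : unitInterval → unitInterval → ℝ := fun x y =>
    if x < y ∧ IsDensityPoint A (x, y) then if IsDensityPoint B (x, y) then 1 else U x y else 0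
  have hU' : IsDigraphKernel U' := by
    refine ⟨?_, fun x y => ?_⟩
    · have hs : MeasurableSet {p : unitInterval × unitInterval |
          p.1 < p.2 ∧ IsDensityPoint A (p.1, p.2)} :=
        (measurableSet_lt measurable_fst measurable_snd).inter (measurableSet_isDensityPoint hA)
      exact Measurable.ite hs (Measurable.ite (measurableSet_isDensityPoint hB)
        measurable_const hU.measurable) measurable_const
    · simp only [U']
      split_ifs
      · exact ⟨zero_le_one, le_rfl⟩
      · exact hU.mem_Icc x y
      · exact ⟨le_rfl, zero_le_one⟩
  have hpos : ∀ {x y}, 0 < U' x y → x < y ∧ IsDensityPoint A (x, y) := fun {x y} h => by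
    by_contra hn
    simp only [U', if_neg hn, lt_irrefl] at h
  refine ⟨U', ⟨⟨inferInstance, inferInstance, measurableSet_lt measurable_fst measurable_snd⟩,
    hU'.measurable, hU'.mem_Icc, fun x y h => (hpos h).1, fun x y z hxy hyz => ?_⟩, hU', ?_⟩
  · have hB' : IsDensityPoint B (x, z) :=
      IsDensityPoint.trans (A := A) (B := A) (C := B) hA hB (hT.ae_eq_one hU) (hpos hxy).2
        (hpos hyz).2
    simp only [U', if_pos (And.intro ((hpos hxy).1.trans (hpos hyz).1) (hB'.mono hBA)), if_pos hB']
  · filter_upwards [ae_isDensityPoint_iff hA, ae_isDensityPoint_iff hB, hlt] with p hpA hpB hp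
    simp only [U', hpA, hpB]
    by_cases h0 : 0 < U p.1 p.2
    · rw [if_pos ⟨hp h0, h0⟩]
      split_ifs with h1
      · exact h1.symm
      · rfl
    · rw [if_neg fun h => h0 h.2]
      exact le_antisymm (hU.mem_Icc _ _).1 (not_lt.1 h0)

end

/-! ### Poset densities as digraph densities, and the theorem -/

open Classical in
/-- The edges of a poset: all pairs in strict order. -/
noncomputable def posetEdges (P : Type*) [Fintype P] [PartialOrder P] : Finset (P × P) :=
  {p | p.1 < p.2}

lemma isOriented_posetEdges (P : Type*) [Fintype P] [PartialOrder P] :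
    IsOriented (posetEdges P) := fun p hp hp' => by
  simp only [posetEdges, Finset.mem_filter, Finset.mem_univ, true_and, Prod.fst_swap,
    Prod.snd_swap] at hp hp'
  exact lt_asymm hp hp'

lemma kernelDensity_eq_digraphDensity (P : Type*) [Fintype P] [PartialOrder P] {S : Type*}
    [MeasurableSpace S] (μ : Measure S) (W : S → S → ℝ) :
    kernelDensity P μ W = digraphDensity (posetEdges P) μ W := rfl

section

variable (Q : Type*) [Fintype Q] [Nonempty Q] [MeasurableSpace Q]

/-- The uniform distribution on a finite type. -/
noncomputable def uniformProbability : ProbabilityMeasure Q :=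
  ⟨(PMF.uniformOfFintype Q).toMeasure, inferInstance⟩

open Classical in
/-- The adjacency function of a strict order. -/
noncomputable def ltWeight {Q : Type*} [PartialOrder Q] (x y : Q) : unitInterval :=
  if x < y then 1 else 0

variable [DiscreteMeasurableSpace Q] [PartialOrder Q]

lemma digraphDensity_uniformProbability (P : Type*) [Fintype P] [PartialOrder P] :
    digraphDensity (posetEdges P) (uniformProbability Q : Measure Q)
      (fun x y => (ltWeight x y : ℝ)) = posetDensity P Q := by
  classical
  have hsingle : ∀ x : P → Q, (Measure.pi fun _ : P => (uniformProbability Q : Measure Q)).real {x} =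
      (Nat.card (P → Q) : ℝ)⁻¹ := fun x => by
    rw [measureReal_def, Measure.pi_singleton]
    have : ∀ i, (uniformProbability Q : Measure Q) {x i} = (Fintype.card Q : ENNReal)⁻¹ :=
      fun i => by
        change (PMF.uniformOfFintype Q).toMeasure {x i} = _
        rw [PMF.toMeasure_apply_singleton _ _ (measurableSet_singleton _),
          PMF.uniformOfFintype_apply]
    simp [this]
  have hprod : ∀ x : P → Q, ∏ p ∈ posetEdges P, (ltWeight (x p.1) (x p.2) : ℝ) =
      if StrictMono x then 1 else 0 := fun x => by
    split_ifs with hx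
    · refine Finset.prod_eq_one fun p hp => ?_
      have : p.1 < p.2 := by simpa [posetEdges] using hp
      simp [ltWeight, hx this]
    · simp only [StrictMono, not_forall] at hx
      obtain ⟨a, b, hab, hx⟩ := hx
      refine Finset.prod_eq_zero (i := (a, b)) (by simpa [posetEdges] using hab) ?_
      simp [ltWeight, hx]
  rw [digraphDensity, integral_fintype Integrable.of_finite]
  simp only [hsingle, hprod, smul_eq_mul, ← Finset.mul_sum, Finset.sum_boole]
  rw [posetDensity, div_eq_inv_mul, Nat.card_eq_fintype_card (α := {f : P → Q // StrictMono f}),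
    Fintype.card_subtype]

end

/-- Transitivity identifies paths with chains, and there are no cycles. -/
lemma isTransitiveInDensity_ltWeight (Q : Type*) [MeasurableSpace Q] [PartialOrder Q]
    (μ : Measure Q) :
    IsTransitiveInDensity μ fun x y : Q => (ltWeight x y : ℝ) where
  path_eq_chain := by
    refine integral_congr_ae (ae_of_all _ fun x => ?_)
    simp only [prod_pathEdges, prod_chainEdges, ltWeight]
    by_cases h1 : x 0 < x 1
    · by_cases h2 : x 1 < x 2
      · simp [h1, h2, h1.trans h2]
      · simp [h2]
    · simp [h1]
  cycle_eq_zero := by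
    refine integral_eq_zero_of_ae (ae_of_all _ fun x => ?_)
    simp only [prod_cycleEdges, ltWeight, Pi.zero_apply]
    by_cases h1 : x 0 < x 1
    · by_cases h2 : x 1 < x 2
      · simp [(h1.trans h2).not_gt]
      · simp [h2]
    · simp [h1]

lemma exists_isPosetKernel_of_nonempty (Q : ℕ → Type u) [∀ n, Fintype (Q n)]
    [∀ n, PartialOrder (Q n)] [∀ n, Nonempty (Q n)]
    (hQ : ∀ (P : Type v) [Fintype P] [PartialOrder P],
      ∃ l : ℝ, Tendsto (fun n => posetDensity P (Q n)) atTop (𝓝 l)) :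
    ∃ U : unitInterval → unitInterval → ℝ,
      IsPosetKernel (volume : Measure unitInterval) (fun x y => x < y) U ∧
        ∀ (P : Type v) [Fintype P] [PartialOrder P],
          Tendsto (fun n => posetDensity P (Q n)) atTop (𝓝 (kernelDensity P volume U)) := by
  let _ : ∀ n, MeasurableSpace (Q n) := fun _ => ⊤
  have : ∀ n, DiscreteMeasurableSpace (Q n) := fun _ => ⟨fun _ => trivial⟩
  obtain ⟨τ, μ, W, hlim⟩ := exists_isLimitKernel (hyperfilter ℕ)
    (fun n => uniformProbability (Q n)) (fun n x y => ltWeight x y)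
  have hW := hlim.isDigraphKernel
  have hT : IsTransitiveInDensity (μ : Measure VertexType) W := by
    refine ⟨tendsto_nhds_unique (hlim.tendsto_digraphDensity isOriented_pathEdges)
      ((hlim.tendsto_digraphDensity isOriented_chainEdges).congr fun n => ?_),
      tendsto_nhds_unique (hlim.tendsto_digraphDensity isOriented_cycleEdges)
        (tendsto_const_nhds.congr fun n => ?_)⟩
    · exact (isTransitiveInDensity_ltWeight (Q n) _).path_eq_chain.symm
    · exact (isTransitiveInDensity_ltWeight (Q n) _).cycle_eq_zero.symm
  obtain ⟨U₀, hU₀, hdens, hT₀, hlt⟩ := exists_ordered_kernel.{v} hW hT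
  obtain ⟨U, hU, hUker, hae⟩ := exists_isPosetKernel_ae_eq hU₀ hT₀ hlt
  refine ⟨U, hU, fun P _ _ => ?_⟩
  classical
  obtain ⟨l, hl⟩ := hQ P
  have h1 : Tendsto (fun n => posetDensity P (Q n)) (hyperfilter ℕ)
      (𝓝 (kernelDensity P volume U)) := by
    rw [kernelDensity_eq_digraphDensity,
      digraphDensity_congr_ae hUker hU₀ hae (isOriented_posetEdges P),
      hdens _ (isOriented_posetEdges P)]
    exact (hlim.tendsto_digraphDensity (isOriented_posetEdges P)).congr fun n =>
      digraphDensity_uniformProbability (Q n) P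
  rwa [tendsto_nhds_unique h1 (hl.mono_left Nat.hyperfilter_le_atTop)]

theorem mainTheorem1 (Q : ℕ → Type u) [∀ n, Fintype (Q n)] [∀ n, PartialOrder (Q n)]
    (hQ : PosetSeqConverges.{u, v} Q) :
    ∃ U : unitInterval → unitInterval → ℝ,
      IsPosetKernel (volume : Measure unitInterval) (fun x y => x < y) U ∧
        ∀ (P : Type v) [Fintype P] [PartialOrder P],
          Tendsto (fun n => posetDensity P (Q n)) atTop (𝓝 (kernelDensity P volume U)) := by
  obtain ⟨hcard, hconv⟩ := hQ
  obtain ⟨N, hN⟩ := (tendsto_atTop.1 hcard 1).exists_forall_of_atTop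
  have : ∀ n, Nonempty (Q (n + N)) := fun n =>
    Fintype.card_pos_iff.1 (hN (n + N) (Nat.le_add_left _ _))
  obtain ⟨U, hU, hlim⟩ := exists_isPosetKernel_of_nonempty.{u, v} (fun n => Q (n + N))
    fun P _ _ => (hconv P).imp fun l hl =>
      (tendsto_add_atTop_iff_nat (f := fun n => posetDensity P (Q n)) N).2 hl
  exact ⟨U, hU, fun P _ _ =>
    (tendsto_add_atTop_iff_nat (f := fun n => posetDensity P (Q n)) N).1 (hlim P)⟩
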